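/- Let $p>1$. There exists $\varepsilon_1>0$, depending only on $p$, such that the following holds. Let $u_0\in W^{1,1}(\mathbb R)\cap W^{1,p}(\mathbb R)$ and $u_1\in L^1(\mathbb R)\cap L^p(\mathbb R)$ satisfy \[ \|u_0\|_{W^{1,1}\cap W^{1,p}}+\|u_1\|_{L^1\cap L^p}\le \varepsilon_1 \] (sums of the respective norms) and, for almost every $x\in\mathbb R$, \[ u_0(x)\le 0,\qquad u_1(x)+\tfrac12 u_0(x)\le 0 . \] Then the Cauchy problem \[ \partial_t^2u+\partial_tu-\partial_x^2u=|u|^p\quad (t>0,\ x\in\mathbb R),\qquad u(0)=u_0,\quad \partial_tu(0)=u_1, \] has a global mild solution \[ u\in C([0,\infty);W^{1,1}\cap W^{1,p})\cap C^1((0,\infty);L^1\cap L^p) \] with $u(t,x)\le 0$ for all $t\ge 0$ and $x\in\mathbb R$. Here a global mild solution is a function $u\in C([0,\infty);L^1\cap L^p)$ (represented pointwise) such that, for all $t\ge0$ and $x\in\mathbb R$, \[ u(t,x)=S(t)(u_0+u_1)(x)+\partial_tS(t)u_0(x)+\int_0^tS(t-\tau)\big(|u(\tau)|^p\big)(x)\,d\tau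 , \] where \[ S(t)f(x)=\frac12\int_{-t}^{t}e^{-t/2}I_0\Big(\frac{\sqrt{t^2-y^2}}{2}\Big)f(x-y)\,dy, \qquad I_0(z)=\sum_{k=0}^\infty\frac{1}{(k!)^2}\Big(\frac z2\Big)^{2k}, \] and $\partial_t S(t)$ at $t=0$ is the right derivative. -/

import Mathlib

open MeasureTheory Set Filter Topology
open scoped ENNReal ContDiff

namespace DampedWave

/-- `g` is the weak derivative of `f` on the real line. -/
def HasWeakDeriv (f g : ℝ → ℝ) : Prop :=
  LocallyIntegrable f ∧ LocallyIntegrable g ∧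
    ∀ φ : ℝ → ℝ, ContDiff ℝ ∞ φ → HasCompactSupport φ →
      ∫ x, f x * deriv φ x = -∫ x, g x * φ x

/-- `f ∈ W^{1,q}`. -/
def MemW (q : ℝ≥0∞) (f : ℝ → ℝ) : Prop :=
  MemLp f q ∧ ∃ g, HasWeakDeriv f g ∧ MemLp g q

/-- The norm `‖f‖_{L^q} + ‖f'‖_{L^q}` of `W^{1,q}`. Weak derivatives are unique up to null sets, so
the infimum runs over a single value if `f` has a weak derivative; it is `⊤` if `f` has none. -/
noncomputable def normW (q : ℝ≥0∞) (f : ℝ → ℝ) : ℝ≥0∞ :=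
  ⨅ g, ⨅ _ : HasWeakDeriv f g, eLpNorm f q volume + eLpNorm g q volume

/-- `f ∈ L^1 ∩ L^p`. -/
def MemL1Lp (p : ℝ) (f : ℝ → ℝ) : Prop :=
  MemLp f 1 ∧ MemLp f (ENNReal.ofReal p)

/-- The norm of `L^1 ∩ L^p`. -/
noncomputable def normL1Lp (p : ℝ) (f : ℝ → ℝ) : ℝ≥0∞ :=
  eLpNorm f 1 volume + eLpNorm f (ENNReal.ofReal p) volume

/-- `f ∈ W^{1,1} ∩ W^{1,p}`. -/
def MemW1Wp (p : ℝ) (f : ℝ → ℝ) : Prop :=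
  MemW 1 f ∧ MemW (ENNReal.ofReal p) f

/-- The norm of `W^{1,1} ∩ W^{1,p}`. -/
noncomputable def normW1Wp (p : ℝ) (f : ℝ → ℝ) : ℝ≥0∞ :=
  normW 1 f + normW (ENNReal.ofReal p) f

/-- `u ∈ C(I; L^1 ∩ L^p)`. -/
def ContinuousL1Lp (p : ℝ) (I : Set ℝ) (u : ℝ → ℝ → ℝ) : Prop :=
  ∀ t ∈ I, MemL1Lp p (u t) ∧
    Tendsto (fun s => normL1Lp p (fun x => u s x - u t x)) (𝓝[I] t) (𝓝 0)

/-- `u ∈ C(I; W^{1,1} ∩ W^{1,p})`. -/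
def ContinuousW1Wp (p : ℝ) (I : Set ℝ) (u : ℝ → ℝ → ℝ) : Prop :=
  ∀ t ∈ I, MemW1Wp p (u t) ∧
    Tendsto (fun s => normW1Wp p (fun x => u s x - u t x)) (𝓝[I] t) (𝓝 0)

/-- `u ∈ C^1(I; L^1 ∩ L^p)` (used for open `I`): `u` is differentiable at every `t ∈ I` as a curve
in `L^1 ∩ L^p`, and its derivative `v` is continuous. -/
def C1L1Lp (p : ℝ) (I : Set ℝ) (u : ℝ → ℝ → ℝ) : Prop :=
  ContinuousL1Lp p I u ∧
    ∃ v : ℝ → ℝ → ℝ, ContinuousL1Lp p I v ∧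
      ∀ t ∈ I, Tendsto
        (fun s => normL1Lp p (fun x => (s - t)⁻¹ * (u s x - u t x) - v t x))
        (𝓝[I \ {t}] t) (𝓝 0)

/-- The modified Bessel function `I_ℓ` of the first kind, of integer order `ℓ ≥ 0`. -/
noncomputable def besselI (ℓ : ℕ) (z : ℝ) : ℝ :=
  ∑' k : ℕ, 1 / ((k.factorial : ℝ) * ((k + ℓ).factorial : ℝ)) * (z / 2) ^ (2 * k + ℓ)

/-- The propagator `S(t)` of the damped wave equation in one space dimension. -/
noncomputable def S (t : ℝ) (f : ℝ → ℝ) (x : ℝ) : ℝ :=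
  (1 / 2) * ∫ y in (-t)..t,
    Real.exp (-t / 2) * besselI 0 (Real.sqrt (t ^ 2 - y ^ 2) / 2) * f (x - y)

/-- `∂_t S(t) f (x)` for `t ≥ 0` (the right derivative at `t = 0`). -/
noncomputable def dtS (t : ℝ) (f : ℝ → ℝ) (x : ℝ) : ℝ :=
  derivWithin (fun s => S s f x) (Ici 0) t

/-- `u` is a mild solution on `[0, ∞)` of `∂_t² u + ∂_t u - ∂_x² u = |u|^p`, `u(0) = u₀`,
`∂_t u(0) = u₁`: it lies in `C([0, ∞); L^1 ∩ L^p)` and satisfies the Duhamel formula.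
The fields `differentiable` and `integrable` say that the terms of the formula are meaningful. -/
structure IsGlobalMildSolution (p : ℝ) (u₀ u₁ : ℝ → ℝ) (u : ℝ → ℝ → ℝ) : Prop where
  continuous : ContinuousL1Lp p (Ici 0) u
  differentiable : ∀ t, 0 ≤ t → ∀ x,
    DifferentiableWithinAt ℝ (fun s => S s u₀ x) (Ici 0) t
  integrable : ∀ t, 0 ≤ t → ∀ x,
    IntervalIntegrable (fun τ => S (t - τ) (fun y => |u τ y| ^ p) x) volume 0 t
  duhamel : ∀ t, 0 ≤ t → ∀ x,
    u t x = S t (fun y => u₀ y + u₁ y) x + dtS t u₀ x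
      + ∫ τ in (0 : ℝ)..t, S (t - τ) (fun y => |u τ y| ^ p) x

end DampedWave

open DampedWave

namespace DampedWave

/-! Put `v = -u` and `w = e^{t/2} v`. The equation becomes `w_tt = w_xx + H` with `H = e^{t/2} (v/4
- v^p)`, and the data become `f₀ = -u₀` and `f₁ = -(u₁ + u₀/2)`, which are exactly the two
quantities assumed nonnegative. If `0 ≤ v ≤ M` with `p M^{p-1} ≤ 1/4`, then `0 ≤ H ≤ (M/4) e^{t/2}`.
In one dimension the d'Alembert kernel is nonnegative, so `w ≥ 0`. Integrating the upper bound twice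
in time gives `w ≤ M e^{t/2}`, that is `v ≤ M`, provided the free wave stays in `[0, M]`; smallness
of the data in `W^{1,1}` and `L^1` ensures this. With the source truncated outside `[0, M]`,
Duhamel's formula for the wave equation is a contraction in a weighted sup norm, and its fixed point
never meets the truncation (`exists_wave_solution`).

The mild formulation uses `S(t)`, which is `e^{-t/2}` times the propagator `kgOp` of `w_tt = w_xx +
w/4`. Its kernel `E(t² - y²)`, `E(r) = I₀(√r/2)`, is the Riemann function, governed by `(r E')' =
E/16`. From this equation follows the resolvent identity `integral_kgOp_waveOp` between the two
propagators. It yields both the time derivative of `S(t)` (`hasDerivWithinAt_S`) and the passage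
from one Duhamel formula to the other (`eq_duhamel_kgOp`), with no differentiation of the kernel
under the integral.

In the Klein-Gordon form only the absorption `-e^{t/2} v^p` remains as a source. Since `kgOp` is
positive, `w` lies below the free Klein-Gordon evolution, and this bounds `w` in `L^1` and `L^p` on
bounded time intervals. Regularity comes from d'Alembert: `(∂_t ± ∂_x) w` is a translate of the data
plus an integral of `H` along characteristics, hence continuous in `L^q`. Half the sum and half the
difference are `w_t` and `w_x` (`continuousLq_of_dAlembert`). -/

/-! ### Interval integrals: exchange of order and integration by parts -/

theorem _root_.MeasureTheory.LocallyIntegrable.intervalIntegrable' {g : ℝ → ℝ}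
    (hg : LocallyIntegrable g) (a b : ℝ) : IntervalIntegrable g volume a b :=
  intervalIntegrable_iff.2
    ((hg.integrableOn_isCompact isCompact_uIcc).mono_set uIoc_subset_uIcc)

/-- The order of integration over a triangle can be exchanged. -/
theorem integral_triangle_swap {φ : ℝ → ℝ → ℝ} (hφ : Continuous (Function.uncurry φ)) {a b : ℝ}
    (hab : a ≤ b) :
    ∫ t in a..b, ∫ s in a..t, φ t s = ∫ s in a..b, ∫ t in s..b, φ t s := by
  have hmeas : MeasurableSet {z : ℝ × ℝ | z.2 ≤ z.1} := measurableSet_le measurable_snd measurable_fst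
  have hint : IntegrableOn
      (Function.uncurry fun t s => {z : ℝ × ℝ | z.2 ≤ z.1}.indicator (Function.uncurry φ) (t, s))
      (uIoc a b ×ˢ uIoc a b) := by
    have h1 : IntegrableOn (Function.uncurry φ) (uIcc a b ×ˢ uIcc a b) :=
      hφ.continuousOn.integrableOn_compact (isCompact_uIcc.prod isCompact_uIcc)
    exact (h1.mono_set (prod_mono uIoc_subset_uIcc uIoc_subset_uIcc)).indicator hmeas
  have hswap := intervalIntegral_intervalIntegral_swap hint
  have hl : ∫ t in a..b, ∫ s in a..b,
      {z : ℝ × ℝ | z.2 ≤ z.1}.indicator (Function.uncurry φ) (t, s)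
        = ∫ t in a..b, ∫ s in a..t, φ t s := by
    refine intervalIntegral.integral_congr fun t ht => ?_
    rw [uIcc_of_le hab] at ht
    exact intervalIntegral.integral_indicator (f := φ t) ht
  have hr : ∫ s in a..b, ∫ t in a..b,
      {z : ℝ × ℝ | z.2 ≤ z.1}.indicator (Function.uncurry φ) (t, s)
        = ∫ s in a..b, ∫ t in s..b, φ t s := by
    refine intervalIntegral.integral_congr fun s hs => ?_
    rw [uIcc_of_le hab] at hs
    have hc : Continuous fun t => φ t s := by fun_prop
    have e1 : ∫ t in a..s, {z : ℝ × ℝ | z.2 ≤ z.1}.indicator (Function.uncurry φ) (t, s) = 0 := by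
      rw [intervalIntegral.integral_of_le hs.1, integral_Ioc_eq_integral_Ioo]
      refine setIntegral_eq_zero_of_forall_eq_zero fun t ht => ?_
      simp [indicator, ht.2]
    have e2 : ∫ t in s..b, {z : ℝ × ℝ | z.2 ≤ z.1}.indicator (Function.uncurry φ) (t, s)
        = ∫ t in s..b, φ t s := by
      refine intervalIntegral.integral_congr fun t ht => ?_
      rw [uIcc_of_le hs.2] at ht
      simp [indicator, ht.1]
    have hI : ∀ c d, IntervalIntegrable
        (fun t => {z : ℝ × ℝ | z.2 ≤ z.1}.indicator (Function.uncurry φ) (t, s)) volume c d := by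
      intro c d
      have : (fun t => {z : ℝ × ℝ | z.2 ≤ z.1}.indicator (Function.uncurry φ) (t, s))
          = (Ici s).indicator fun t => φ t s := by
        ext t; simp [indicator]
      rw [this, intervalIntegrable_iff]
      exact (intervalIntegrable_iff.1 (hc.intervalIntegrable c d)).indicator measurableSet_Ici
    calc _ = (∫ t in a..s, {z : ℝ × ℝ | z.2 ≤ z.1}.indicator (Function.uncurry φ) (t, s))
          + ∫ t in s..b, {z : ℝ × ℝ | z.2 ≤ z.1}.indicator (Function.uncurry φ) (t, s) :=
          (intervalIntegral.integral_add_adjacent_intervals (hI a s) (hI s b)).symm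
      _ = _ := by rw [e1, e2, zero_add]
  rw [← hl, ← hr]
  exact hswap

@[fun_prop]
theorem continuous_intervalIntegral_of_continuous {X : Type*} [TopologicalSpace X]
    [FirstCountableTopology X] {f : X → ℝ → ℝ} (hf : Continuous (Function.uncurry f)) {a b : X → ℝ}
    (ha : Continuous a) (hb : Continuous b) : Continuous fun x => ∫ t in (a x)..(b x), f x t := by
  have h0 : ∀ x, ∫ t in (a x)..(b x), f x t
      = (∫ t in (0 : ℝ)..(b x), f x t) - ∫ t in (0 : ℝ)..(a x), f x t := fun x =>
    (intervalIntegral.integral_interval_sub_left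
      (Continuous.intervalIntegrable (by fun_prop) _ _)
      (Continuous.intervalIntegrable (by fun_prop) _ _)).symm
  simp only [h0]
  fun_prop

/-- Fubini for interval integrals of a continuous function. -/
theorem integral_swap_of_continuous {φ : ℝ → ℝ → ℝ} (hφ : Continuous (Function.uncurry φ))
    (a b c d : ℝ) :
    ∫ t in a..b, ∫ s in c..d, φ t s = ∫ s in c..d, ∫ t in a..b, φ t s := by
  refine intervalIntegral_intervalIntegral_swap ?_
  exact (hφ.continuousOn.integrableOn_compact (isCompact_uIcc.prod isCompact_uIcc)).mono_set
    (prod_mono uIoc_subset_uIcc uIoc_subset_uIcc)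

/-- The two descriptions of a double integral over `{s, σ ≥ 0, s + σ ≤ t}`. -/
theorem integral_convolution_swap {k : ℝ → ℝ → ℝ} (hk : Continuous (Function.uncurry k)) {t : ℝ}
    (ht : 0 ≤ t) :
    ∫ τ in (0 : ℝ)..t, ∫ σ in (0 : ℝ)..τ, k (t - τ) σ
      = ∫ r in (0 : ℝ)..t, ∫ σ in (0 : ℝ)..r, k (r - σ) σ := by
  rw [integral_triangle_swap (φ := fun τ σ => k (t - τ) σ) (by fun_prop) ht,
    integral_triangle_swap (φ := fun r σ => k (r - σ) σ) (by fun_prop) ht]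
  refine intervalIntegral.integral_congr fun σ _ => ?_
  rw [intervalIntegral.integral_comp_sub_left (fun s => k s σ),
    intervalIntegral.integral_comp_sub_right (fun s => k s σ)]
  simp

/-- Integration by parts against a primitive of a locally integrable function. -/
theorem integral_mul_eq_of_primitive {g Q u u' : ℝ → ℝ} {a b : ℝ}
    (hgi : IntervalIntegrable g volume a b) (hQ : ∀ a b, Q b - Q a = ∫ y in a..b, g y) (hu : ∀ y, HasDerivAt u (u' y) y)
    (hu' : Continuous u') :
    ∫ y in a..b, u y * g y = u b * Q b - u a * Q a - ∫ y in a..b, u' y * Q y := by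
  have hQe : Q = fun y => Q a + ∫ v in a..y, g v := by
    ext y; rw [← hQ a y]; ring
  -- `Q` is differentiable only almost everywhere; absolute continuity is what justifies the
  -- integration by parts.
  have hQac : AbsolutelyContinuousOnInterval Q a b := by
    have h1 := hgi.absolutelyContinuousOnInterval_intervalIntegral (c := a) (by simp)
    have h2 : AbsolutelyContinuousOnInterval (fun _ : ℝ => Q a) a b :=
      contDiffOn_const.absolutelyContinuousOnInterval
    rw [hQe]
    exact h2.add h1
  have hder : ∀ y, deriv u y = u' y := fun y => (hu y).deriv
  have huac : AbsolutelyContinuousOnInterval u a b := by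
    have : ContDiff ℝ 1 u := by
      rw [contDiff_one_iff_deriv]
      refine ⟨fun y => (hu y).differentiableAt, ?_⟩
      rw [show deriv u = u' from funext hder]; exact hu'
    exact this.contDiffOn.absolutelyContinuousOnInterval
  have := huac.integral_mul_deriv_eq_deriv_mul hQac
  simp only [hder] at this
  rw [← this]
  refine intervalIntegral.integral_congr_ae ?_
  filter_upwards [hgi.ae_hasDerivAt_integral] with y hy hy'
  have h := hy (uIoc_subset_uIcc hy') a (by simp)
  have h2 : HasDerivAt Q (g y) y := by
    rw [hQe]; exact h.const_add _
  rw [h2.deriv]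

/-! ### The Riemann function and its differential equation -/

/-- Termwise differentiation of a power series with coefficients bounded by `1 / n!`. -/
theorem hasDerivAt_tsum_pow {a : ℕ → ℝ} (ha : ∀ n, |a n| ≤ 1 / (n.factorial : ℝ)) (r : ℝ) :
    HasDerivAt (fun x => ∑' n, a n * x ^ n) (∑' n : ℕ, a n * (n * r ^ (n - 1))) r := by
  -- The ball of radius `R` about `0` contains both `r` and the base point `0`, at which the series
  -- trivially converges.
  set R : ℝ := |r| + 1 with hR
  have hR0 : 0 < R := by positivity
  have hsum : Summable fun n : ℕ => 1 / (n.factorial : ℝ) * (n * R ^ (n - 1)) := by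
    rw [← summable_nat_add_iff 1]
    refine (Real.summable_pow_div_factorial R).congr fun n => ?_
    rw [Nat.factorial_succ]
    have h1 : (n.factorial : ℝ) ≠ 0 := by positivity
    have h2 : (n : ℝ) + 1 ≠ 0 := by positivity
    simp only [Nat.add_sub_cancel]
    push_cast
    field_simp
  refine hasDerivAt_tsum_of_isPreconnected (g := fun n x => a n * x ^ n)
    (g' := fun n x => a n * (n * x ^ (n - 1))) (t := Metric.ball 0 R) hsum Metric.isOpen_ball
    (convex_ball 0 R).isPreconnected (fun n y _ => (hasDerivAt_pow n y).const_mul (a n))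
    (fun n y hy => ?_) (y₀ := 0) (Metric.mem_ball_self hR0) ?_ ?_
  · have hy' : |y| ≤ R := by
      have := mem_ball_zero_iff.1 hy
      exact this.le
    rw [norm_mul, norm_mul, norm_pow, Real.norm_eq_abs, Real.norm_eq_abs, Real.norm_eq_abs,
      Nat.abs_cast]
    gcongr
    exact ha n
  · refine summable_of_ne_finset_zero (s := {0}) fun n hn => ?_
    have : n ≠ 0 := by simpa using hn
    simp [this]
  · simp [hR]

theorem summable_mul_pow {a : ℕ → ℝ} (ha : ∀ n, |a n| ≤ 1 / (n.factorial : ℝ)) (r : ℝ) :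
    Summable fun n => a n * r ^ n := by
  refine Summable.of_norm_bounded (Real.summable_pow_div_factorial |r|) fun n => ?_
  rw [norm_mul, norm_pow, Real.norm_eq_abs, Real.norm_eq_abs]
  calc |a n| * |r| ^ n ≤ 1 / (n.factorial : ℝ) * |r| ^ n := by gcongr; exact ha n
    _ = _ := by ring

/-- The coefficients of the Riemann function. -/
noncomputable def riemannCoeff (n : ℕ) : ℝ := 1 / (16 ^ n * (n.factorial : ℝ) ^ 2)

/-- The Riemann function `r ↦ I₀(√r / 2)`, as an entire function of `r`. -/
noncomputable def riemannFun (r : ℝ) : ℝ := ∑' n, riemannCoeff n * r ^ n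

/-- The derivative of `riemannFun`. -/
noncomputable def riemannDeriv (r : ℝ) : ℝ := ∑' n : ℕ, riemannCoeff n * (n * r ^ (n - 1))

theorem riemannCoeff_nonneg (n : ℕ) : 0 ≤ riemannCoeff n := by
  unfold riemannCoeff; positivity

theorem riemannCoeff_succ (n : ℕ) :
    riemannCoeff (n + 1) * ((n + 1 : ℕ) * (n + 1 : ℕ)) = riemannCoeff n / 16 := by
  unfold riemannCoeff
  rw [Nat.factorial_succ, pow_succ]
  have h1 : (n.factorial : ℝ) ≠ 0 := by positivity
  have h2 : (n : ℝ) + 1 ≠ 0 := by positivity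
  push_cast
  field_simp

theorem abs_natCast_mul_riemannCoeff_le (n : ℕ) :
    |n * riemannCoeff n| ≤ 1 / (n.factorial : ℝ) := by
  rw [abs_of_nonneg (mul_nonneg n.cast_nonneg (riemannCoeff_nonneg n))]
  unfold riemannCoeff
  have h1 : (1 : ℝ) ≤ n.factorial := by exact_mod_cast n.factorial_pos
  have h2 : (n : ℝ) ≤ n.factorial := by exact_mod_cast n.self_le_factorial
  have h3 : (1 : ℝ) ≤ 16 ^ n := one_le_pow₀ (by norm_num)
  rw [mul_one_div, div_le_div_iff₀ (by positivity) (by positivity)]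
  nlinarith [mul_le_mul h2 h3 zero_le_one (by positivity),
    mul_nonneg (sub_nonneg.2 h3) (sq_nonneg (n.factorial : ℝ))]

theorem abs_riemannCoeff_le (n : ℕ) : |riemannCoeff n| ≤ 1 / (n.factorial : ℝ) := by
  rw [abs_of_nonneg (riemannCoeff_nonneg n)]
  unfold riemannCoeff
  have h1 : (1 : ℝ) ≤ n.factorial := by exact_mod_cast n.factorial_pos
  have h3 : (1 : ℝ) ≤ 16 ^ n := one_le_pow₀ (by norm_num)
  apply one_div_le_one_div_of_le (by positivity)
  nlinarith [mul_nonneg (sub_nonneg.2 h3) (sq_nonneg (n.factorial : ℝ))]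

theorem hasDerivAt_riemannFun (r : ℝ) : HasDerivAt riemannFun (riemannDeriv r) r :=
  hasDerivAt_tsum_pow abs_riemannCoeff_le r

/-- The coefficient recursion `(n+1)² c_{n+1} = c_n / 16` is the equation `(r E')' = E/16`. In the
characteristic coordinates `t - y`, `t + y` it says that `E(t² - y²)` solves `w_tt = w_yy + w/4`. -/
theorem hasDerivAt_mul_riemannDeriv (r : ℝ) :
    HasDerivAt (fun x => x * riemannDeriv x) (riemannFun r / 16) r := by
  have h := hasDerivAt_tsum_pow abs_natCast_mul_riemannCoeff_le r
  have e1 : (fun x : ℝ => ∑' n : ℕ, (n * riemannCoeff n) * x ^ n)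
      = fun x => x * riemannDeriv x := by
    ext x
    rw [riemannDeriv, ← tsum_mul_left]
    refine tsum_congr fun n => ?_
    rcases n with _ | n
    · simp
    · simp only [Nat.add_sub_cancel]; ring
  have e2 : (∑' n : ℕ, (n * riemannCoeff n) * (n * r ^ (n - 1))) = riemannFun r / 16 := by
    have hs : Summable fun n : ℕ => ((n : ℝ) * riemannCoeff n) * (n * r ^ (n - 1)) := by
      rw [← summable_nat_add_iff 1]
      refine ((summable_mul_pow abs_riemannCoeff_le r).div_const 16).congr fun n => ?_
      rw [mul_div_right_comm, ← riemannCoeff_succ]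
      simp only [Nat.add_sub_cancel]; ring
    rw [hs.tsum_eq_zero_add, riemannFun, ← tsum_div_const]
    simp only [Nat.cast_zero, zero_mul, zero_add]
    refine tsum_congr fun n => ?_
    rw [mul_div_right_comm, ← riemannCoeff_succ]
    simp only [Nat.add_sub_cancel]; ring
  rwa [e1, e2] at h

theorem continuous_riemannFun : Continuous riemannFun :=
  continuous_iff_continuousAt.2 fun r => (hasDerivAt_riemannFun r).continuousAt

theorem riemannDeriv_eq (r : ℝ) :
    riemannDeriv r = ∑' n : ℕ, ((n + 1 : ℕ) * riemannCoeff (n + 1)) * r ^ n := by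
  have hc : ∀ n : ℕ, |((n + 1 : ℕ) : ℝ) * riemannCoeff (n + 1)| ≤ 1 / (n.factorial : ℝ) := fun n =>
    (abs_natCast_mul_riemannCoeff_le (n + 1)).trans (one_div_le_one_div_of_le (by positivity)
      (by exact_mod_cast Nat.factorial_le n.le_succ))
  have hs : Summable fun n : ℕ => riemannCoeff n * (n * r ^ (n - 1)) := by
    rw [← summable_nat_add_iff 1]
    refine (summable_mul_pow hc r).congr fun n => ?_
    simp only [Nat.add_sub_cancel]; ring
  rw [riemannDeriv, hs.tsum_eq_zero_add]
  simp only [Nat.cast_zero, zero_mul, mul_zero, zero_add]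
  refine tsum_congr fun n => ?_
  simp only [Nat.add_sub_cancel]; ring

theorem continuous_riemannDeriv : Continuous riemannDeriv := by
  have hc : ∀ n : ℕ, |((n + 1 : ℕ) : ℝ) * riemannCoeff (n + 1)| ≤ 1 / (n.factorial : ℝ) := fun n =>
    (abs_natCast_mul_riemannCoeff_le (n + 1)).trans (one_div_le_one_div_of_le (by positivity)
      (by exact_mod_cast Nat.factorial_le n.le_succ))
  rw [show riemannDeriv = _ from funext riemannDeriv_eq]
  exact continuous_iff_continuousAt.2 fun r => (hasDerivAt_tsum_pow hc r).continuousAt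

theorem riemannFun_zero : riemannFun 0 = 1 := by
  rw [riemannFun, tsum_eq_single 0]
  · simp [riemannCoeff]
  · intro n hn; simp [hn]

theorem riemannDeriv_zero : riemannDeriv 0 = 1 / 16 := by
  rw [riemannDeriv_eq, tsum_eq_single 0]
  · simp [riemannCoeff]
  · intro n hn; simp [hn]

theorem riemannFun_nonneg {r : ℝ} (hr : 0 ≤ r) : 0 ≤ riemannFun r :=
  tsum_nonneg fun n => mul_nonneg (riemannCoeff_nonneg n) (pow_nonneg hr n)

theorem besselI_zero_sqrt {r : ℝ} (hr : 0 ≤ r) : besselI 0 (Real.sqrt r / 2) = riemannFun r := by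
  rw [besselI, riemannFun]
  refine tsum_congr fun n => ?_
  rw [add_zero, add_zero, pow_mul, div_div, div_pow, Real.sq_sqrt hr, riemannCoeff, div_pow]
  norm_num
  field_simp

/-- The equation of the Riemann function, integrated once. -/
theorem integral_riemannFun_mul (a R : ℝ) :
    ∫ r in (0 : ℝ)..R, riemannFun (r * a) = 16 * R * riemannDeriv (R * a) := by
  rcases eq_or_ne a 0 with rfl | ha
  · simp [riemannFun_zero, riemannDeriv_zero]; ring
  · have hd : ∀ r, HasDerivAt (fun r => 16 / a * ((r * a) * riemannDeriv (r * a)))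
        (riemannFun (r * a)) r := by
      intro r
      have h1 : HasDerivAt (fun r : ℝ => r * a) a r := by
        simpa using (hasDerivAt_id r).mul_const a
      have h2 := ((hasDerivAt_mul_riemannDeriv (r * a)).comp r h1).const_mul (16 / a)
      refine h2.congr_deriv ?_
      field_simp
    rw [intervalIntegral.integral_eq_sub_of_hasDerivAt (fun r _ => hd r)
      ((continuous_riemannFun.comp (by fun_prop)).intervalIntegrable _ _)]
    simp only [zero_mul, mul_zero, sub_zero]
    field_simp

/-! ### The wave and Klein-Gordon propagators and the identity relating them -/

/-- The solution operator of `w_tt = w_xx`, `w(0) = 0`, `w_t(0) = f`. -/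
noncomputable def waveOp (t : ℝ) (f : ℝ → ℝ) (x : ℝ) : ℝ :=
  1 / 2 * ∫ y in (-t)..t, f (x - y)

/-- The solution operator of `w_tt = w_xx + w / 4`, `w(0) = 0`, `w_t(0) = f`. -/
noncomputable def kgOp (t : ℝ) (f : ℝ → ℝ) (x : ℝ) : ℝ :=
  1 / 2 * ∫ y in (-t)..t, riemannFun (t ^ 2 - y ^ 2) * f (x - y)

theorem S_eq_exp_mul_kgOp {t : ℝ} (ht : 0 ≤ t) (f : ℝ → ℝ) (x : ℝ) :
    S t f x = Real.exp (-t / 2) * kgOp t f x := by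
  rw [S, kgOp, mul_left_comm, ← intervalIntegral.integral_const_mul (Real.exp (-t / 2))]
  congr 1
  refine intervalIntegral.integral_congr fun y hy => ?_
  rw [uIcc_of_le (by linarith)] at hy
  have : 0 ≤ t ^ 2 - y ^ 2 := by nlinarith [hy.1, hy.2]
  simp only [besselI_zero_sqrt this, mul_assoc]

theorem waveOp_eq_of_primitive {f P : ℝ → ℝ} (hP : ∀ a b, P b - P a = ∫ y in a..b, f y)
    (t x : ℝ) : waveOp t f x = 1 / 2 * (P (x + t) - P (x - t)) := by
  rw [waveOp, intervalIntegral.integral_comp_sub_left (fun z => f z), hP, sub_neg_eq_add]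

/-- Shifting `y` by `t - s` freezes the argument of `P`. With `r = 2s - t`, whence a factor `1/2`,
the kernel becomes `E((r - y)(y + t))`, whose argument is affine in `r`. After the exchange of order
the `r`-integral is `integral_riemannFun_mul`, whence `16/2 = 8`. -/
theorem integral_cone_riemannFun_add {P : ℝ → ℝ} (hP : Continuous P) {t : ℝ} (ht : 0 ≤ t) (x : ℝ) :
    ∫ s in (0 : ℝ)..t, ∫ y in (-s)..s, riemannFun (s ^ 2 - y ^ 2) * P (x - y + (t - s))
      = 8 * ∫ y in (-t)..t, (t - y) * riemannDeriv (t ^ 2 - y ^ 2) * P (x - y) := by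
  have hE := continuous_riemannFun
  have h1 : ∀ s, ∫ y in (-s)..s, riemannFun (s ^ 2 - y ^ 2) * P (x - y + (t - s))
      = ∫ y in (-t)..(2 * s - t), riemannFun ((2 * s - t - y) * (y + t)) * P (x - y) := by
    intro s
    have := intervalIntegral.integral_comp_add_right (a := -t) (b := 2 * s - t)
      (fun y => riemannFun (s ^ 2 - y ^ 2) * P (x - y + (t - s))) (t - s)
    rw [show -t + (t - s) = -s by ring, show 2 * s - t + (t - s) = s by ring] at this
    rw [← this]
    refine intervalIntegral.integral_congr fun y _ => ?_
    congr 2 <;> ring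
  have h2 := intervalIntegral.integral_comp_mul_add (a := 0) (b := t) (c := 2)
    (fun r => ∫ y in (-t)..r, riemannFun ((r - y) * (y + t)) * P (x - y)) (by norm_num) (-t)
  simp only [h1]
  simp only [← sub_eq_add_neg] at h2
  rw [h2, show (2 : ℝ) * 0 - t = -t by ring, show 2 * t - t = t by ring,
    integral_triangle_swap (φ := fun r y => riemannFun ((r - y) * (y + t)) * P (x - y))
      (by fun_prop) (by linarith), smul_eq_mul, ← intervalIntegral.integral_const_mul,
    ← intervalIntegral.integral_const_mul]
  refine intervalIntegral.integral_congr fun y _ => ?_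
  rw [intervalIntegral.integral_mul_const,
    intervalIntegral.integral_comp_sub_right (fun r => riemannFun (r * (y + t))), sub_self,
    integral_riemannFun_mul, show (t - y) * (y + t) = t ^ 2 - y ^ 2 by ring]
  ring

theorem integral_cone_riemannFun_sub {P : ℝ → ℝ} (hP : Continuous P) {t : ℝ} (ht : 0 ≤ t) (x : ℝ) :
    ∫ s in (0 : ℝ)..t, ∫ y in (-s)..s, riemannFun (s ^ 2 - y ^ 2) * P (x - y - (t - s))
      = 8 * ∫ y in (-t)..t, (t + y) * riemannDeriv (t ^ 2 - y ^ 2) * P (x - y) := by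
  have h := integral_cone_riemannFun_add (P := fun z => P (-z)) (by fun_prop) ht (-x)
  have e1 : ∀ s, ∫ y in (-s)..s, riemannFun (s ^ 2 - y ^ 2) * P (-(-x - y + (t - s)))
      = ∫ y in (-s)..s, riemannFun (s ^ 2 - y ^ 2) * P (x - y - (t - s)) := by
    intro s
    have := intervalIntegral.integral_comp_neg (a := -s) (b := s)
      (fun y => riemannFun (s ^ 2 - y ^ 2) * P (x - y - (t - s)))
    rw [neg_neg] at this
    rw [← this]
    refine intervalIntegral.integral_congr fun y _ => ?_
    congr 2 <;> ring
  have e2 : ∫ y in (-t)..t, (t - y) * riemannDeriv (t ^ 2 - y ^ 2) * P (-(-x - y))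
      = ∫ y in (-t)..t, (t + y) * riemannDeriv (t ^ 2 - y ^ 2) * P (x - y) := by
    have := intervalIntegral.integral_comp_neg (a := -t) (b := t)
      (fun y => (t + y) * riemannDeriv (t ^ 2 - y ^ 2) * P (x - y))
    rw [neg_neg] at this
    rw [← this]
    refine intervalIntegral.integral_congr fun y _ => ?_
    rw [neg_sq, ← sub_eq_add_neg]
    congr 2; ring
  simp only [e1, e2] at h
  exact h

/-- Duhamel's formula relating the two solution operators. -/
theorem integral_kgOp_waveOp {f : ℝ → ℝ} (hfi : ∀ a b, IntervalIntegrable f volume a b) {t : ℝ} (ht : 0 ≤ t) (x : ℝ) :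
    ∫ τ in (0 : ℝ)..t, kgOp (t - τ) (waveOp τ f) x = 4 * (kgOp t f x - waveOp t f x) := by
  have hE := continuous_riemannFun
  have hE' := continuous_riemannDeriv
  -- As `f` is only locally integrable, both sides are rewritten as integrals of `E'` against its
  -- continuous primitive.
  set P : ℝ → ℝ := fun z => ∫ y in (0 : ℝ)..z, f y with hPdef
  have hPc : Continuous P := intervalIntegral.continuous_primitive hfi 0
  have hP : ∀ a b, P b - P a = ∫ y in a..b, f y := fun a b => by
    rw [hPdef]
    exact intervalIntegral.integral_interval_sub_left (hfi 0 b) (hfi 0 a)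
  have hlhs : ∫ τ in (0 : ℝ)..t, kgOp (t - τ) (waveOp τ f) x
      = -4 * ∫ y in (-t)..t, y * riemannDeriv (t ^ 2 - y ^ 2) * P (x - y) := by
    have e1 := intervalIntegral.integral_comp_sub_left (a := 0) (b := t)
      (fun s => kgOp s (waveOp (t - s) f) x) t
    simp only [sub_sub_cancel, sub_self, sub_zero] at e1
    rw [e1]
    have e2 : ∀ s, kgOp s (waveOp (t - s) f) x
        = 1 / 4 * (∫ y in (-s)..s, riemannFun (s ^ 2 - y ^ 2) * P (x - y + (t - s)))
          - 1 / 4 * ∫ y in (-s)..s, riemannFun (s ^ 2 - y ^ 2) * P (x - y - (t - s)) := by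
      intro s
      rw [kgOp, ← mul_sub, ← intervalIntegral.integral_sub
        (Continuous.intervalIntegrable (by fun_prop) _ _)
        (Continuous.intervalIntegrable (by fun_prop) _ _),
        ← intervalIntegral.integral_const_mul, ← intervalIntegral.integral_const_mul]
      refine intervalIntegral.integral_congr fun y _ => ?_
      simp only [waveOp_eq_of_primitive hP]
      ring
    simp only [e2]
    rw [intervalIntegral.integral_sub
        (Continuous.intervalIntegrable (by fun_prop) _ _)
        (Continuous.intervalIntegrable (by fun_prop) _ _),
      intervalIntegral.integral_const_mul, intervalIntegral.integral_const_mul,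
      integral_cone_riemannFun_add hPc ht, integral_cone_riemannFun_sub hPc ht,
      ← mul_assoc, ← mul_assoc, ← mul_sub, ← intervalIntegral.integral_sub
        (Continuous.intervalIntegrable (by fun_prop) _ _)
        (Continuous.intervalIntegrable (by fun_prop) _ _),
      ← intervalIntegral.integral_const_mul, ← intervalIntegral.integral_const_mul]
    refine intervalIntegral.integral_congr fun y _ => ?_
    ring
  have hfx : IntervalIntegrable (fun y => f (x - y)) volume (-t) t := by
    simpa using (hfi (x + t) (x - t)).comp_sub_left x
  have hprim : ∀ a b, (-P (x - b)) - (-P (x - a)) = ∫ y in a..b, f (x - y) := by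
    intro a b
    rw [intervalIntegral.integral_comp_sub_left (fun z => f z), ← hP]
    ring
  have hu : ∀ y, HasDerivAt (fun y => riemannFun (t ^ 2 - y ^ 2))
      (-(2 * y) * riemannDeriv (t ^ 2 - y ^ 2)) y := by
    intro y
    have h1 : HasDerivAt (fun y : ℝ => t ^ 2 - y ^ 2) (-(2 * y)) y := by
      simpa using (hasDerivAt_pow 2 y).const_sub (t ^ 2)
    have := (hasDerivAt_riemannFun (t ^ 2 - y ^ 2)).comp y h1
    rw [mul_comm]
    exact this
  -- The boundary terms sit at `y = ±t`, where the kernel is `E(0) = 1`; they are exactly the wave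
  -- operator and cancel.
  have hrhs : kgOp t f x - waveOp t f x
      = - ∫ y in (-t)..t, y * riemannDeriv (t ^ 2 - y ^ 2) * P (x - y) := by
    rw [kgOp, integral_mul_eq_of_primitive hfx hprim hu (by fun_prop), neg_sq, sub_self,
      riemannFun_zero, waveOp_eq_of_primitive hP]
    have : ∫ y in (-t)..t, -(2 * y) * riemannDeriv (t ^ 2 - y ^ 2) * -P (x - y)
        = 2 * ∫ y in (-t)..t, y * riemannDeriv (t ^ 2 - y ^ 2) * P (x - y) := by
      rw [← intervalIntegral.integral_const_mul]
      refine intervalIntegral.integral_congr fun y _ => ?_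
      ring
    rw [this, sub_neg_eq_add]
    ring
  rw [hlhs, hrhs]
  ring

/-! ### Continuity and linearity of the propagators; wave source terms -/

/-- The solution operator of `w_tt = w_xx`, `w(0) = f`, `w_t(0) = 0`. -/
noncomputable def avgOp (t : ℝ) (f : ℝ → ℝ) (x : ℝ) : ℝ := 1 / 2 * (f (x + t) + f (x - t))

@[fun_prop]
theorem continuous_avgOp {X : Type*} [TopologicalSpace X] {f : X → ℝ → ℝ} {a b : X → ℝ}
    (hf : Continuous (Function.uncurry f)) (ha : Continuous a)
    (hb : Continuous b) : Continuous fun q => avgOp (a q) (f q) (b q) := by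
  unfold avgOp
  have h1 : Continuous fun q => f q (b q + a q) :=
    hf.comp (by fun_prop : Continuous fun q => (q, b q + a q))
  have h2 : Continuous fun q => f q (b q - a q) :=
    hf.comp (by fun_prop : Continuous fun q => (q, b q - a q))
  fun_prop

section continuity

variable {X : Type*} [TopologicalSpace X] [FirstCountableTopology X] {f : X → ℝ → ℝ} {a b : X → ℝ}

@[fun_prop]
theorem continuous_waveOp (hf : Continuous (Function.uncurry f)) (ha : Continuous a)
    (hb : Continuous b) : Continuous fun q => waveOp (a q) (f q) (b q) := by
  unfold waveOp
  have h : Continuous (Function.uncurry fun q y => f q (b q - y)) :=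
    hf.comp (by fun_prop : Continuous fun z : X × ℝ => (z.1, b z.1 - z.2))
  fun_prop

@[fun_prop]
theorem continuous_kgOp (hf : Continuous (Function.uncurry f)) (ha : Continuous a)
    (hb : Continuous b) : Continuous fun q => kgOp (a q) (f q) (b q) := by
  unfold kgOp
  have hE := continuous_riemannFun
  have h : Continuous (Function.uncurry fun q y => riemannFun (a q ^ 2 - y ^ 2) * f q (b q - y)) :=
    (by fun_prop : Continuous fun z : X × ℝ => riemannFun (a z.1 ^ 2 - z.2 ^ 2)).mul
      (hf.comp (by fun_prop : Continuous fun z : X × ℝ => (z.1, b z.1 - z.2)))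
  fun_prop

end continuity

theorem continuous_waveOp_of_intervalIntegrable {f : ℝ → ℝ}
    (hf : ∀ a b, IntervalIntegrable f volume a b) :
    Continuous (Function.uncurry fun t x => waveOp t f x) := by
  have hP := intervalIntegral.continuous_primitive hf 0
  have : (Function.uncurry fun t x => waveOp t f x) = fun z : ℝ × ℝ =>
      1 / 2 * ((∫ y in (0 : ℝ)..(z.2 + z.1), f y) - ∫ y in (0 : ℝ)..(z.2 - z.1), f y) := by
    ext z
    exact waveOp_eq_of_primitive (fun a b =>
      intervalIntegral.integral_interval_sub_left (hf 0 b) (hf 0 a)) _ _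
  rw [this]
  fun_prop

theorem kgOp_add {f g : ℝ → ℝ} (hf : ∀ a b, IntervalIntegrable f volume a b)
    (hg : ∀ a b, IntervalIntegrable g volume a b) (t x : ℝ) :
    kgOp t (fun y => f y + g y) x = kgOp t f x + kgOp t g x := by
  have hE := continuous_riemannFun
  have h : ∀ f : ℝ → ℝ, (∀ a b, IntervalIntegrable f volume a b) →
      IntervalIntegrable (fun y => riemannFun (t ^ 2 - y ^ 2) * f (x - y)) volume (-t) t := by
    intro f hf
    refine IntervalIntegrable.continuousOn_mul ?_ (by fun_prop)
    simpa using (hf (x + t) (x - t)).comp_sub_left x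
  simp only [kgOp, mul_add]
  rw [intervalIntegral.integral_add (h f hf) (h g hg), mul_add]

theorem kgOp_const_mul (c : ℝ) (f : ℝ → ℝ) (t x : ℝ) :
    kgOp t (fun y => c * f y) x = c * kgOp t f x := by
  simp only [kgOp]
  rw [mul_left_comm c, ← intervalIntegral.integral_const_mul c]
  simp only [mul_left_comm c]

theorem kgOp_integral {φ : ℝ → ℝ → ℝ} (hφ : Continuous (Function.uncurry φ)) (s x a b : ℝ) :
    kgOp s (fun y => ∫ σ in a..b, φ σ y) x = ∫ σ in a..b, kgOp s (φ σ) x := by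
  have hE := continuous_riemannFun
  unfold kgOp
  rw [intervalIntegral.integral_const_mul, integral_swap_of_continuous (by fun_prop)]
  simp only [intervalIntegral.integral_const_mul]

/-- The Klein-Gordon operator applied to a wave source term. -/
theorem integral_kgOp_integral_waveOp {G : ℝ → ℝ → ℝ} (hG : Continuous (Function.uncurry G))
    {t : ℝ} (ht : 0 ≤ t) (x : ℝ) :
    ∫ τ in (0 : ℝ)..t, kgOp (t - τ) (fun y => ∫ σ in (0 : ℝ)..τ, waveOp (τ - σ) (G σ) y) x
      = 4 * ((∫ σ in (0 : ℝ)..t, kgOp (t - σ) (G σ) x)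
        - ∫ σ in (0 : ℝ)..t, waveOp (t - σ) (G σ) x) := by
  have hw : Continuous fun z : ℝ × ℝ × ℝ => waveOp (z.1 - z.2.1) (G z.2.1) z.2.2 :=
    continuous_waveOp (f := fun z : ℝ × ℝ × ℝ => G z.2.1) (by fun_prop) (by fun_prop) (by fun_prop)
  have e1 : ∀ τ, kgOp (t - τ) (fun y => ∫ σ in (0 : ℝ)..τ, waveOp (τ - σ) (G σ) y) x
      = ∫ σ in (0 : ℝ)..τ, kgOp (t - τ) (waveOp (τ - σ) (G σ)) x := fun τ =>
    kgOp_integral (φ := fun σ y => waveOp (τ - σ) (G σ) y)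
      (hw.comp (by fun_prop : Continuous fun z : ℝ × ℝ => (τ, z.1, z.2))) _ _ _ _
  simp only [e1]
  -- After the exchange, each fixed `σ` leaves `integral_kgOp_waveOp` for `G σ` on the time interval
  -- `[σ, t]`.
  rw [integral_triangle_swap (φ := fun τ σ => kgOp (t - τ) (waveOp (τ - σ) (G σ)) x) ?_ ht,
    mul_sub, ← intervalIntegral.integral_const_mul, ← intervalIntegral.integral_const_mul,
    ← intervalIntegral.integral_sub]
  · refine intervalIntegral.integral_congr fun σ hσ => ?_
    rw [uIcc_of_le ht] at hσ
    have hc : Continuous (G σ) := by fun_prop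
    have h := integral_kgOp_waveOp (f := G σ) (fun a b => hc.intervalIntegrable a b)
      (t := t - σ) (by linarith [hσ.2]) x
    have h2 := intervalIntegral.integral_comp_sub_right (a := σ) (b := t)
      (fun r => kgOp (t - σ - r) (waveOp r (G σ)) x) σ
    rw [sub_self] at h2
    rw [mul_sub] at h
    rw [← h, ← h2]
    simp only [sub_sub, add_sub_cancel]
  · refine Continuous.intervalIntegrable ?_ _ _
    exact (continuous_kgOp (f := fun σ : ℝ => G σ) hG (by fun_prop) (by fun_prop)).const_mul 4
  · refine Continuous.intervalIntegrable ?_ _ _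
    exact (continuous_waveOp (f := fun σ : ℝ => G σ) hG (by fun_prop) (by fun_prop)).const_mul 4
  · refine continuous_kgOp (f := fun z : ℝ × ℝ => waveOp (z.1 - z.2) (G z.2)) ?_
      (by fun_prop) (by fun_prop)
    exact hw.comp (by fun_prop : Continuous fun z : (ℝ × ℝ) × ℝ => (z.1.1, z.1.2, z.2))

theorem intervalIntegrable_comp_add {f : ℝ → ℝ} (hf : ∀ a b, IntervalIntegrable f volume a b)
    (x a b : ℝ) : IntervalIntegrable (fun y => f (x + y)) volume a b := by
  simpa using (hf (x + a) (x + b)).comp_add_left x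

theorem intervalIntegrable_comp_sub {f : ℝ → ℝ} (hf : ∀ a b, IntervalIntegrable f volume a b)
    (x a b : ℝ) : IntervalIntegrable (fun y => f (x - y)) volume a b := by
  simpa using (hf (x - a) (x - b)).comp_sub_left x

theorem waveOp_eq_integral_avgOp {f : ℝ → ℝ} (hf : ∀ a b, IntervalIntegrable f volume a b)
    (t x : ℝ) :
    waveOp t f x = ∫ σ in (0 : ℝ)..t, avgOp σ f x := by
  have h : ∀ σ, avgOp σ f x = 1 / 2 * f (x + σ) + 1 / 2 * f (x - σ) := fun σ => by
    rw [avgOp]; ring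
  simp only [h]
  rw [intervalIntegral.integral_add ((intervalIntegrable_comp_add hf x _ _).const_mul _)
    ((intervalIntegrable_comp_sub hf x _ _).const_mul _), intervalIntegral.integral_const_mul,
    intervalIntegral.integral_const_mul, intervalIntegral.integral_comp_add_left (fun z => f z),
    intervalIntegral.integral_comp_sub_left (fun z => f z), waveOp,
    intervalIntegral.integral_comp_sub_left (fun z => f z), ← mul_add, add_zero, sub_zero,
    sub_neg_eq_add, add_comm (∫ y in x..(x + t), f y),
    intervalIntegral.integral_add_adjacent_intervals (hf _ _) (hf _ _)]

/-! ### Time derivative of the propagator, and Duhamel's formula for Klein-Gordon -/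

/-- The solution operator of `w_tt = w_xx + w / 4`, `w(0) = f`, `w_t(0) = 0`. -/
noncomputable def kgAvgOp (t : ℝ) (f : ℝ → ℝ) (x : ℝ) : ℝ :=
  avgOp t f x + 1 / 4 * ∫ σ in (0 : ℝ)..t, kgOp (t - σ) (avgOp σ f) x

theorem continuous_kgOp_avgOp {f : ℝ → ℝ} (hf : Continuous f) (x : ℝ) :
    Continuous (Function.uncurry fun s σ => kgOp s (avgOp σ f) x) := by
  refine continuous_kgOp (f := fun z : ℝ × ℝ => avgOp z.2 f) ?_ (by fun_prop) (by fun_prop)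
  exact continuous_avgOp (f := fun _ => f) (by fun_prop) (by fun_prop) (by fun_prop)

theorem continuous_kgAvgOp {f : ℝ → ℝ} (hf : Continuous f) (x : ℝ) :
    Continuous fun t => kgAvgOp t f x := by
  have h1 := continuous_kgOp_avgOp hf x
  have h2 : Continuous fun t => avgOp t f x :=
    continuous_avgOp (f := fun _ => f) (by fun_prop) (by fun_prop) (by fun_prop)
  have h3 : Continuous (Function.uncurry fun t σ => kgOp (t - σ) (avgOp σ f) x) :=
    h1.comp (by fun_prop : Continuous fun z : ℝ × ℝ => (z.1 - z.2, z.2))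
  unfold kgAvgOp
  fun_prop

/-- `kgAvgOp` is built by perturbing `avgOp`, not by differentiating `kgOp`. Writing `waveOp` as a
time integral of `avgOp` in the resolvent identity and re-indexing the double integral by total time
shows that its time integral is `kgOp`. Since it is continuous in time for continuous `f`, this
gives differentiability, one-sided at `0`. -/
theorem kgOp_eq_integral_kgAvgOp {f : ℝ → ℝ} (hf : Continuous f) {t : ℝ} (ht : 0 ≤ t) (x : ℝ) :
    kgOp t f x = ∫ r in (0 : ℝ)..t, kgAvgOp r f x := by
  have hk := continuous_kgOp_avgOp hf x
  have h := integral_kgOp_waveOp (fun a b => hf.intervalIntegrable a b) ht x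
  have e1 : ∀ τ, kgOp (t - τ) (waveOp τ f) x
      = ∫ σ in (0 : ℝ)..τ, kgOp (t - τ) (avgOp σ f) x := by
    intro τ
    rw [show waveOp τ f = fun y => ∫ σ in (0 : ℝ)..τ, avgOp σ f y from
      funext fun y => waveOp_eq_integral_avgOp (fun a b => hf.intervalIntegrable a b) τ y]
    refine kgOp_integral (φ := fun σ y => avgOp σ f y) ?_ _ _ _ _
    exact continuous_avgOp (f := fun _ => f) (by fun_prop) (by fun_prop) (by fun_prop)
  simp only [e1] at h
  rw [integral_convolution_swap hk ht] at h
  have h2 : Continuous fun t => avgOp t f x :=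
    continuous_avgOp (f := fun _ => f) (by fun_prop) (by fun_prop) (by fun_prop)
  have h3 : Continuous (Function.uncurry fun t σ => kgOp (t - σ) (avgOp σ f) x) :=
    hk.comp (by fun_prop : Continuous fun z : ℝ × ℝ => (z.1 - z.2, z.2))
  unfold kgAvgOp
  rw [intervalIntegral.integral_add (Continuous.intervalIntegrable (by fun_prop) _ _)
    (Continuous.intervalIntegrable (by fun_prop) _ _), intervalIntegral.integral_const_mul, h,
    ← waveOp_eq_integral_avgOp (fun a b => hf.intervalIntegrable a b)]
  ring

theorem hasDerivWithinAt_kgOp {f : ℝ → ℝ} (hf : Continuous f) {t : ℝ} (ht : 0 ≤ t) (x : ℝ) :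
    HasDerivWithinAt (fun s => kgOp s f x) (kgAvgOp t f x) (Ici 0) t := by
  have h : HasDerivAt (fun t => ∫ r in (0 : ℝ)..t, kgAvgOp r f x) (kgAvgOp t f x) t :=
    (continuous_kgAvgOp hf x).integral_hasStrictDerivAt 0 t |>.hasDerivAt
  exact h.hasDerivWithinAt.congr (fun s hs => kgOp_eq_integral_kgAvgOp hf hs x)
    (kgOp_eq_integral_kgAvgOp hf ht x)

/-- The propagator of the damped wave equation is differentiable in time. -/
theorem hasDerivWithinAt_S {f : ℝ → ℝ} (hf : Continuous f) {t : ℝ} (ht : 0 ≤ t) (x : ℝ) :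
    HasDerivWithinAt (fun s => S s f x)
      (Real.exp (-t / 2) * (kgAvgOp t f x - 1 / 2 * kgOp t f x)) (Ici 0) t := by
  have h1 : HasDerivAt (fun s : ℝ => Real.exp (-s / 2)) (Real.exp (-t / 2) * (-1 / 2)) t :=
    (((hasDerivAt_id t).neg).div_const 2).exp
  have h2 := h1.hasDerivWithinAt.mul (hasDerivWithinAt_kgOp hf ht x)
  refine (h2.congr (fun s hs => S_eq_exp_mul_kgOp hs f x) (S_eq_exp_mul_kgOp ht f x)).congr_deriv ?_
  ring

/-- A solution of the wave equation with source `w / 4 - F` is given by Duhamel's formula for the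
Klein-Gordon operators. -/
theorem eq_duhamel_kgOp {f₀ f₁ : ℝ → ℝ} {w F : ℝ → ℝ → ℝ} (hf₀ : Continuous f₀)
    (hf₁ : ∀ a b, IntervalIntegrable f₁ volume a b) (hw : Continuous (Function.uncurry w))
    (hF : Continuous (Function.uncurry F))
    (heq : ∀ t, 0 ≤ t → ∀ x, w t x = avgOp t f₀ x + waveOp t f₁ x
      + ∫ τ in (0 : ℝ)..t, waveOp (t - τ) (fun z => 1 / 4 * w τ z - F τ z) x)
    {t : ℝ} (ht : 0 ≤ t) (x : ℝ) :
    w t x = kgAvgOp t f₀ x + kgOp t f₁ x - ∫ τ in (0 : ℝ)..t, kgOp (t - τ) (F τ) x := by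
  set G : ℝ → ℝ → ℝ := fun τ z => 1 / 4 * w τ z - F τ z with hGdef
  have hG : Continuous (Function.uncurry G) := by fun_prop
  have hB : Continuous (Function.uncurry fun τ y => ∫ σ in (0 : ℝ)..τ, waveOp (τ - σ) (G σ) y) := by
    have : Continuous (Function.uncurry fun (z : ℝ × ℝ) σ => waveOp (z.1 - σ) (G σ) z.2) :=
      continuous_waveOp (f := fun q : (ℝ × ℝ) × ℝ => G q.2) (by fun_prop) (by fun_prop)
        (by fun_prop)
    exact continuous_intervalIntegral_of_continuous this continuous_const continuous_fst
  have hA : Continuous (Function.uncurry fun τ y => avgOp τ f₀ y) :=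
    continuous_avgOp (f := fun _ => f₀) (by fun_prop) (by fun_prop) (by fun_prop)
  have hW := continuous_waveOp_of_intervalIntegrable hf₁
  have hkg : ∀ φ : ℝ → ℝ → ℝ, Continuous (Function.uncurry φ) →
      IntervalIntegrable (fun τ => kgOp (t - τ) (φ τ) x) volume 0 t := fun φ hφ =>
    (continuous_kgOp hφ (by fun_prop) (by fun_prop)).intervalIntegrable _ _
  have hii : ∀ φ : ℝ → ℝ → ℝ, Continuous (Function.uncurry φ) → ∀ τ a b,
      IntervalIntegrable (φ τ) volume a b := fun φ hφ τ a b =>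
    (hφ.comp (by fun_prop : Continuous fun y => (τ, y))).intervalIntegrable _ _
  have h1 : ∫ τ in (0 : ℝ)..t, kgOp (t - τ) (w τ) x
      = (∫ τ in (0 : ℝ)..t, kgOp (t - τ) (avgOp τ f₀) x)
        + (∫ τ in (0 : ℝ)..t, kgOp (t - τ) (waveOp τ f₁) x)
        + ∫ τ in (0 : ℝ)..t, kgOp (t - τ)
            (fun y => ∫ σ in (0 : ℝ)..τ, waveOp (τ - σ) (G σ) y) x := by
    rw [← intervalIntegral.integral_add (hkg _ hA) (hkg _ hW),
      ← intervalIntegral.integral_add ((hkg _ hA).add (hkg _ hW)) (hkg _ hB)]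
    refine intervalIntegral.integral_congr fun τ hτ => ?_
    rw [uIcc_of_le ht] at hτ
    rw [← kgOp_add (hii _ hA τ) (hii _ hW τ),
      ← kgOp_add (fun a b => (hii _ hA τ a b).add (hii _ hW τ a b)) (hii _ hB τ)]
    congr 1
    ext y
    exact heq τ hτ.1 y
  have h2 : ∫ τ in (0 : ℝ)..t, kgOp (t - τ) (G τ) x
      = 1 / 4 * (∫ τ in (0 : ℝ)..t, kgOp (t - τ) (w τ) x)
        - ∫ τ in (0 : ℝ)..t, kgOp (t - τ) (F τ) x := by
    rw [← intervalIntegral.integral_const_mul,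
      ← intervalIntegral.integral_sub ((hkg w hw).const_mul _) (hkg F hF)]
    refine intervalIntegral.integral_congr fun τ _ => ?_
    have : G τ = fun z => 1 / 4 * w τ z + (-1) * F τ z := by
      ext z; simp only [hGdef]; ring
    rw [this, kgOp_add (fun a b => (hii w hw τ a b).const_mul _)
      (fun a b => (hii F hF τ a b).const_mul _), kgOp_const_mul, kgOp_const_mul]
    ring
  have h3 := integral_kgOp_waveOp hf₁ ht x
  have h4 := integral_kgOp_integral_waveOp hG ht x
  have h5 := heq t ht x
  -- With `*` the time convolution, `h1` to `h5` are linear in the unknown terms. The term `kgOp *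
  -- w` occurs with coefficient one on both sides and drops out, which absorbs the source `w/4`.
  rw [kgAvgOp]
  linarith

/-! ### The nonlinearity and its truncation -/

section nonlinearity

variable {p M : ℝ}

/-- Mean value inequality: on `[0, M]` the derivative `p r^{p-1}` is at most `1/4`. Hence `r/4 -
r^p` is nonnegative, nondecreasing and `1/4`-Lipschitz there; this is how the size of `M` enters. -/
theorem rpow_sub_rpow_mem_Icc (hp : 1 < p) (hpM : p * M ^ (p - 1) ≤ 1 / 4) {c d : ℝ}
    (hd : 0 ≤ d) (hdc : d ≤ c) (hc : c ≤ M) : c ^ p - d ^ p ∈ Icc 0 (1 / 4 * (c - d)) := by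
  have hmono := Real.rpow_le_rpow hd hdc (by linarith : 0 ≤ p)
  refine ⟨by linarith, ?_⟩
  have h := (convex_Icc 0 M).norm_image_sub_le_of_norm_hasDerivWithin_le (f := fun x : ℝ => x ^ p)
    (f' := fun x => p * x ^ (p - 1)) (C := 1 / 4) (x := d) (y := c)
    (fun x _ => (Real.hasDerivAt_rpow_const (Or.inr hp.le)).hasDerivWithinAt)
    (fun x hx => ?_) ⟨hd, hdc.trans hc⟩ ⟨hd.trans hdc, hc⟩
  · rw [Real.norm_eq_abs, Real.norm_eq_abs, abs_of_nonneg (by linarith),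
      abs_of_nonneg (by linarith)] at h
    exact h
  · have h1 : x ^ (p - 1) ≤ M ^ (p - 1) := Real.rpow_le_rpow hx.1 hx.2 (by linarith)
    have h2 : 0 ≤ x ^ (p - 1) := Real.rpow_nonneg hx.1 _
    rw [Real.norm_eq_abs, abs_of_nonneg (by positivity)]
    nlinarith

/-- The map `r ↦ r / 4 - r ^ p`, extended by constants outside `[0, M]`. -/
noncomputable def clippedSource (p M r : ℝ) : ℝ :=
  1 / 4 * max 0 (min r M) - (max 0 (min r M)) ^ p

theorem clippedSource_of_mem {r : ℝ} (hr : r ∈ Icc 0 M) :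
    clippedSource p M r = 1 / 4 * r - r ^ p := by
  rw [clippedSource, min_eq_left hr.2, max_eq_right hr.1]

theorem continuous_clippedSource (hp : 1 < p) : Continuous (clippedSource p M) := by
  unfold clippedSource
  have h : Continuous fun r : ℝ => max 0 (min r M) := by fun_prop
  exact (h.const_mul _).sub (h.rpow_const fun _ => Or.inr (by linarith))

theorem clippedSource_mem_Icc (hp : 1 < p) (hM : 0 ≤ M) (hpM : p * M ^ (p - 1) ≤ 1 / 4) (r : ℝ) :
    clippedSource p M r ∈ Icc 0 (M / 4) := by
  have h0 : (0 : ℝ) ≤ max 0 (min r M) := le_max_left _ _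
  have h1 : max 0 (min r M) ≤ M := max_le hM (min_le_right _ _)
  have h := rpow_sub_rpow_mem_Icc hp hpM le_rfl h0 h1
  rw [Real.zero_rpow (by linarith)] at h
  rw [clippedSource]
  constructor <;> linarith [h.1, h.2]

theorem abs_clippedSource_sub_le (hp : 1 < p) (hM : 0 ≤ M) (hpM : p * M ^ (p - 1) ≤ 1 / 4)
    (r s : ℝ) : |clippedSource p M r - clippedSource p M s| ≤ 1 / 4 * |r - s| := by
  wlog hrs : s ≤ r generalizing r s
  · rw [abs_sub_comm, abs_sub_comm r]
    exact this s r (le_of_not_ge hrs)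
  have hle : max 0 (min s M) ≤ max 0 (min r M) := by gcongr
  have h := rpow_sub_rpow_mem_Icc hp hpM (le_max_left 0 (min s M)) hle
    (max_le hM (min_le_right _ _))
  have hlip : max 0 (min r M) - max 0 (min s M) ≤ r - s := by
    rcases le_total r M with h1 | h1 <;> rcases le_total s M with h2 | h2 <;>
    rcases le_total 0 r with h3 | h3 <;> rcases le_total 0 s with h4 | h4 <;>
    simp [h1, h2, h3, h4, hM] <;> linarith
  rw [abs_of_nonneg (sub_nonneg.2 hrs), abs_le, clippedSource, clippedSource]
  constructor <;> linarith [h.1, h.2]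

end nonlinearity

/-! ### Existence by contraction -/

theorem abs_waveOp_le {f : ℝ → ℝ} {C t : ℝ} (ht : 0 ≤ t) (hf : ∀ x, |f x| ≤ C) (x : ℝ) :
    |waveOp t f x| ≤ t * C := by
  have h := intervalIntegral.norm_integral_le_of_norm_le_const (a := -t) (b := t)
    (f := fun y => f (x - y)) (C := C) fun y _ => hf _
  rw [sub_neg_eq_add, abs_of_nonneg (by linarith : 0 ≤ t + t), Real.norm_eq_abs] at h
  rw [waveOp, abs_mul, abs_of_pos (by norm_num : (0 : ℝ) < 1 / 2)]
  linarith

theorem waveOp_nonneg {f : ℝ → ℝ} {t : ℝ} (ht : 0 ≤ t) (hf : ∀ᵐ x, 0 ≤ f x) (x : ℝ) :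
    0 ≤ waveOp t f x := by
  rw [waveOp, intervalIntegral.integral_comp_sub_left (fun z => f z)]
  exact mul_nonneg (by norm_num) (intervalIntegral.integral_nonneg_of_ae (by linarith) hf)

theorem waveOp_sub {f g : ℝ → ℝ} (hf : Continuous f) (hg : Continuous g) (t x : ℝ) :
    waveOp t (fun y => f y - g y) x = waveOp t f x - waveOp t g x := by
  rw [waveOp, waveOp, waveOp, ← mul_sub, intervalIntegral.integral_sub
    (Continuous.intervalIntegrable (by fun_prop) _ _)
    (Continuous.intervalIntegrable (by fun_prop) _ _)]

theorem integral_sub_mul_exp {c : ℝ} (hc : c ≠ 0) (t : ℝ) :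
    ∫ τ in (0 : ℝ)..t, (t - τ) * Real.exp (c * τ) = (Real.exp (c * t) - 1 - c * t) / c ^ 2 := by
  have hd : ∀ τ : ℝ, HasDerivAt (fun τ => ((t - τ) / c + 1 / c ^ 2) * Real.exp (c * τ))
      ((t - τ) * Real.exp (c * τ)) τ := by
    intro τ
    have h1 : HasDerivAt (fun τ : ℝ => (t - τ) / c + 1 / c ^ 2) (-1 / c) τ :=
      (((hasDerivAt_id τ).const_sub t).div_const c).add_const _
    have h2 : HasDerivAt (fun τ : ℝ => Real.exp (c * τ)) (Real.exp (c * τ) * c) τ := by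
      simpa using ((hasDerivAt_id τ).const_mul c).exp
    refine (h1.mul h2).congr_deriv ?_
    field_simp
    ring
  rw [intervalIntegral.integral_eq_sub_of_hasDerivAt (fun τ _ => hd τ)
    (Continuous.intervalIntegrable (by fun_prop) _ _)]
  simp only [mul_zero, Real.exp_zero]
  field_simp
  ring

/-- The operator at time lag `t - τ` costs a factor `t - τ`, so the bound is `integral_sub_mul_exp`.
The rate `c = 1/2` serves the a priori bound and `c = 1` the contraction. -/
theorem abs_integral_waveOp_le {H : ℝ → ℝ → ℝ} (hH : Continuous (Function.uncurry H)) {c C t : ℝ}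
    (hc : 0 < c) (ht : 0 ≤ t) (hC : ∀ τ ∈ Icc 0 t, ∀ x, |H τ x| ≤ C * Real.exp (c * τ)) (x : ℝ) :
    |∫ τ in (0 : ℝ)..t, waveOp (t - τ) (H τ) x|
      ≤ C * ((Real.exp (c * t) - 1 - c * t) / c ^ 2) := by
  rw [← integral_sub_mul_exp hc.ne', ← intervalIntegral.integral_const_mul]
  refine (intervalIntegral.abs_integral_le_integral_abs ht).trans ?_
  have hw := continuous_waveOp (f := fun τ : ℝ => H τ) (a := fun τ => t - τ) (b := fun _ => x) hH
    (by fun_prop) (by fun_prop)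
  refine intervalIntegral.integral_mono_on ht (hw.abs.intervalIntegrable _ _)
    (Continuous.intervalIntegrable (by fun_prop) _ _) fun τ hτ => ?_
  refine (abs_waveOp_le (by linarith [hτ.2]) (hC τ hτ) x).trans (le_of_eq ?_)
  ring

theorem continuous_integral_waveOp {H : ℝ → ℝ → ℝ} (hH : Continuous (Function.uncurry H)) :
    Continuous fun z : ℝ × ℝ => ∫ τ in (0 : ℝ)..z.1, waveOp (z.1 - τ) (H τ) z.2 := by
  have : Continuous (Function.uncurry fun (z : ℝ × ℝ) σ => waveOp (z.1 - σ) (H σ) z.2) :=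
    continuous_waveOp (f := fun q : (ℝ × ℝ) × ℝ => H q.2) (by fun_prop) (by fun_prop) (by fun_prop)
  exact continuous_intervalIntegral_of_continuous this continuous_const continuous_fst

open scoped BoundedContinuousFunction in
/-- Existence of a small nonnegative solution of the nonlinear wave equation. -/
theorem exists_wave_solution {p M : ℝ} (hp : 1 < p) (hM : 0 ≤ M) (hpM : p * M ^ (p - 1) ≤ 1 / 4)
    {b : ℝ → ℝ → ℝ} (hb : Continuous (Function.uncurry b))
    (hbM : ∀ t, 0 ≤ t → ∀ x, b t x ∈ Icc 0 M) :
    ∃ v : ℝ → ℝ → ℝ, Continuous (Function.uncurry v) ∧ (∀ t x, v t x ∈ Icc 0 M) ∧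
      ∀ t, 0 ≤ t → ∀ x, Real.exp (t / 2) * v t x = b t x + ∫ τ in (0 : ℝ)..t,
        waveOp (t - τ) (fun z => Real.exp (τ / 2) * (1 / 4 * v τ z - v τ z ^ p)) x := by
  -- The unknown is `g = e^{-t} w = e^{-t/2} v`, so that `e^{τ/2} g` stands for `v`; the extra decay
  -- makes the map contract on all of `[0, ∞)` at once.
  set H : (ℝ × ℝ →ᵇ ℝ) → ℝ → ℝ → ℝ := fun g τ z =>
    Real.exp (τ / 2) * clippedSource p M (Real.exp (τ / 2) * g (τ, z)) with hHdef
  have hcs := continuous_clippedSource (M := M) hp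
  have hHc : ∀ g, Continuous (Function.uncurry (H g)) := by
    intro g
    have hg := g.continuous
    simp only [hHdef]
    fun_prop
  have hHb : ∀ g τ z, |H g τ z| ≤ M / 4 * Real.exp (1 / 2 * τ) := by
    intro g τ z
    have h := clippedSource_mem_Icc hp hM hpM (Real.exp (τ / 2) * g (τ, z))
    rw [abs_of_nonneg (mul_nonneg (Real.exp_pos _).le h.1), mul_comm,
      show 1 / 2 * τ = τ / 2 by ring]
    exact mul_le_mul_of_nonneg_right h.2 (Real.exp_pos _).le
  set Φ : (ℝ × ℝ →ᵇ ℝ) → ℝ × ℝ → ℝ := fun g z =>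
    b z.1 z.2 + ∫ τ in (0 : ℝ)..z.1, waveOp (z.1 - τ) (H g τ) z.2 with hΦdef
  have hΦc : ∀ g, Continuous (Φ g) := fun g => hb.add (continuous_integral_waveOp (hHc g))
  have hΦ : ∀ g t, 0 ≤ t → ∀ x, Φ g (t, x) ∈ Icc 0 (M * Real.exp (t / 2)) := by
    intro g t ht x
    have h1 := hbM t ht x
    have h2 := abs_integral_waveOp_le (hHc g) (by norm_num) ht (fun τ _ => hHb g τ) x
    have h3 : 0 ≤ ∫ τ in (0 : ℝ)..t, waveOp (t - τ) (H g τ) x := by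
      refine intervalIntegral.integral_nonneg ht fun τ hτ => ?_
      exact waveOp_nonneg (by linarith [hτ.2]) (Eventually.of_forall fun z =>
        mul_nonneg (Real.exp_pos _).le (clippedSource_mem_Icc hp hM hpM _).1) x
    rw [abs_of_nonneg h3, show 1 / 2 * t = t / 2 by ring] at h2
    -- The bound `M/4` on the truncated source matches `c² = 1/4`: the integral is at most `M
    -- e^{t/2} - M - M t/2`, and the `-M` pays for the free part.
    have h4 : M / 4 * ((Real.exp (t / 2) - 1 - t / 2) / (1 / 2) ^ 2)
        = M * Real.exp (t / 2) - M - M * (t / 2) := by ring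
    have h5 : 0 ≤ M * (t / 2) := by positivity
    simp only [hΦdef]
    constructor <;> linarith [h1.1, h1.2]
  -- Freezing negative times at `0` keeps the functions on the whole plane; only `t ≥ 0` matters.
  set T : (ℝ × ℝ →ᵇ ℝ) → (ℝ × ℝ →ᵇ ℝ) := fun g =>
    BoundedContinuousFunction.ofNormedAddCommGroup
      (fun z => Real.exp (-max z.1 0) * Φ g (max z.1 0, z.2))
      (by have := hΦc g; fun_prop) M (by
        intro z
        have h := hΦ g (max z.1 0) (le_max_right _ _) z.2
        have h2 : Real.exp (max z.1 0 / 2) ≤ Real.exp (max z.1 0) :=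
          Real.exp_le_exp.2 (by linarith [le_max_right z.1 0])
        rw [Real.norm_eq_abs, abs_of_nonneg (mul_nonneg (Real.exp_pos _).le h.1), Real.exp_neg,
          inv_mul_le_iff₀ (Real.exp_pos _)]
        exact h.2.trans (by rw [mul_comm]; gcongr)) with hTdef
  have hT : ContractingWith (1 / 4) T := by
    refine ⟨by norm_num [← NNReal.coe_lt_coe], LipschitzWith.of_dist_le_mul fun g g' => ?_⟩
    rw [BoundedContinuousFunction.dist_le (by positivity)]
    intro z
    have ht : 0 ≤ max z.1 0 := le_max_right _ _
    simp only [hTdef, BoundedContinuousFunction.coe_ofNormedAddCommGroup]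
    rw [Real.dist_eq, ← mul_sub, abs_mul, abs_of_pos (Real.exp_pos _), Real.exp_neg,
      inv_mul_le_iff₀ (Real.exp_pos _)]
    set t := max z.1 0
    have hdiff : Φ g (t, z.2) - Φ g' (t, z.2)
        = ∫ τ in (0 : ℝ)..t, waveOp (t - τ) (fun y => H g τ y - H g' τ y) z.2 := by
      simp only [hΦdef, add_sub_add_left_eq_sub]
      have hw : ∀ g, Continuous fun τ => waveOp (t - τ) (H g τ) z.2 := fun g =>
        continuous_waveOp (f := fun τ : ℝ => H g τ) (hHc g) (by fun_prop) (by fun_prop)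
      rw [← intervalIntegral.integral_sub ((hw g).intervalIntegrable _ _)
        ((hw g').intervalIntegrable _ _)]
      refine intervalIntegral.integral_congr fun τ _ => (waveOp_sub ?_ ?_ _ _).symm
      · exact (hHc g).comp (by fun_prop : Continuous fun y => (τ, y))
      · exact (hHc g').comp (by fun_prop : Continuous fun y => (τ, y))
    -- One `e^{τ/2}` is the prefactor of `H`, the other comes from its argument. Their product `e^τ`
    -- integrates to at most `e^t`, which the weight `e^{-t}` removes, leaving the factor `1/4`.
    have hbd : ∀ τ ∈ Icc 0 t, ∀ x, |H g τ x - H g' τ x|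
        ≤ 1 / 4 * dist g g' * Real.exp (1 * τ) := by
      intro τ _ x
      have h1 := abs_clippedSource_sub_le hp hM hpM (Real.exp (τ / 2) * g (τ, x))
        (Real.exp (τ / 2) * g' (τ, x))
      have h2 := BoundedContinuousFunction.dist_coe_le_dist (f := g) (g := g') (τ, x)
      rw [Real.dist_eq] at h2
      rw [← mul_sub, abs_mul, abs_of_pos (Real.exp_pos _)] at h1
      simp only [hHdef]
      rw [← mul_sub, abs_mul, abs_of_pos (Real.exp_pos _), one_mul,
        show Real.exp τ = Real.exp (τ / 2) * Real.exp (τ / 2) by rw [← Real.exp_add]; ring_nf]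
      calc _ ≤ Real.exp (τ / 2) * (1 / 4 * (Real.exp (τ / 2) * |g (τ, x) - g' (τ, x)|)) := by gcongr
        _ ≤ Real.exp (τ / 2) * (1 / 4 * (Real.exp (τ / 2) * dist g g')) := by gcongr
        _ = _ := by ring
    have h := abs_integral_waveOp_le (H := fun τ y => H g τ y - H g' τ y)
      ((hHc g).sub (hHc g')) one_pos ht hbd z.2
    rw [hdiff]
    refine h.trans ?_
    have hd : 0 ≤ dist g g' := dist_nonneg
    rw [one_mul, one_pow, div_one]
    push_cast
    nlinarith [mul_nonneg hd ht]
  obtain ⟨g, hg⟩ : ∃ g, T g = g := ⟨hT.fixedPoint T, hT.fixedPoint_isFixedPt⟩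
  have hgeq : ∀ t, 0 ≤ t → ∀ x, Real.exp t * g (t, x) = Φ g (t, x) := by
    intro t ht x
    have h : T g (t, x) = g (t, x) := by rw [hg]
    simp only [hTdef, BoundedContinuousFunction.coe_ofNormedAddCommGroup, max_eq_left ht] at h
    rw [← h, ← mul_assoc, ← Real.exp_add, add_neg_cancel, Real.exp_zero, one_mul]
  -- The a priori bound holds for the fixed point, so the truncation is inactive along it.
  have hmem : ∀ t, 0 ≤ t → ∀ x, Real.exp (t / 2) * g (t, x) ∈ Icc 0 M := by
    intro t ht x
    have h := hΦ g t ht x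
    rw [← hgeq t ht x, show Real.exp t = Real.exp (t / 2) * Real.exp (t / 2) by
      rw [← Real.exp_add]; ring_nf, mul_assoc, mul_comm M] at h
    have he := Real.exp_pos (t / 2)
    exact ⟨nonneg_of_mul_nonneg_right h.1 he, le_of_mul_le_mul_left h.2 he⟩
  refine ⟨fun t x => Real.exp (max t 0 / 2) * g (max t 0, x), ?_, fun t x =>
    hmem _ (le_max_right _ _) x, fun t ht x => ?_⟩
  · have := g.continuous
    fun_prop
  · simp only [max_eq_left ht]
    rw [← mul_assoc, ← Real.exp_add, add_halves, hgeq t ht]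
    simp only [hΦdef]
    congr 1
    refine intervalIntegral.integral_congr fun τ hτ => ?_
    rw [uIcc_of_le ht] at hτ
    simp only [max_eq_left hτ.1]
    congr 1
    ext z
    simp only [hHdef]
    rw [clippedSource_of_mem (hmem τ hτ.1 z)]

/-! ### Weak derivatives on the line and continuous representatives -/

theorem _root_.HasCompactSupport.exists_support_subset_Ioo {φ : ℝ → ℝ} (hφ : HasCompactSupport φ) :
    ∃ R, 0 < R ∧ tsupport φ ⊆ Ioo (-R) R := by
  obtain ⟨R, hR⟩ := hφ.isCompact.isBounded.subset_ball 0
  refine ⟨max R 1, by positivity, fun x hx => ?_⟩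
  have := mem_ball_zero_iff.1 (hR hx)
  exact abs_lt.1 (lt_of_lt_of_le this (le_max_left _ _))

/-- A primitive of a locally integrable function has it as a weak derivative. -/
theorem hasWeakDeriv_of_primitive {F g : ℝ → ℝ} (hF : Continuous F) (hg : LocallyIntegrable g)
    (hFg : ∀ a b, F b - F a = ∫ y in a..b, g y) : HasWeakDeriv F g := by
  refine ⟨hF.locallyIntegrable, hg, fun φ hφ hφc => ?_⟩
  obtain ⟨R, hR, hs⟩ := hφc.exists_support_subset_Ioo
  have hz : ∀ x, x ∉ Ioo (-R) R → φ x = 0 := fun x hx => image_eq_zero_of_notMem_tsupport fun h => hx (hs h)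
  have h1 : Function.support (fun x => F x * deriv φ x) ⊆ Ioc (-R) R := fun x hx =>
    Ioo_subset_Ioc_self (hs (support_deriv_subset (right_ne_zero_of_mul hx)))
  have h2 : Function.support (fun x => g x * φ x) ⊆ Ioc (-R) R := fun x hx =>
    Ioo_subset_Ioc_self (hs (subset_tsupport _ (right_ne_zero_of_mul hx)))
  rw [← intervalIntegral.integral_eq_integral_of_support_subset h1,
    ← intervalIntegral.integral_eq_integral_of_support_subset h2]
  have hd : ∀ y, HasDerivAt φ (deriv φ y) y := fun y =>
    (hφ.differentiable (by simp) y).hasDerivAt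
  have h := integral_mul_eq_of_primitive (hg.intervalIntegrable' (-R) R) hFg hd
    (hφ.continuous_deriv (by simp))
  rw [hz R (by simp), hz (-R) (by simp)] at h
  simp only [mul_comm (g _), mul_comm (F _)]
  rw [h]
  ring

theorem HasWeakDeriv.ae_eq {f g g' : ℝ → ℝ} (h : HasWeakDeriv f g) (h' : HasWeakDeriv f g') :
    g =ᵐ[volume] g' := by
  refine ae_eq_of_integral_contDiff_smul_eq h.2.1 h'.2.1 fun φ hφ hφc => ?_
  have := (h.2.2 φ hφ hφc).symm.trans (h'.2.2 φ hφ hφc)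
  simpa [mul_comm] using this

/-- A smooth compactly supported function of zero mean has a smooth compactly supported
primitive. -/
theorem exists_primitive_hasCompactSupport {θ : ℝ → ℝ} (hθ : ContDiff ℝ ∞ θ)
    (hc : HasCompactSupport θ) (h0 : ∫ x, θ x = 0) :
    ∃ φ : ℝ → ℝ, ContDiff ℝ ∞ φ ∧ HasCompactSupport φ ∧ deriv φ = θ := by
  obtain ⟨R, hR, hs⟩ := hc.exists_support_subset_Ioo
  have hz : ∀ x, x ∉ Ioo (-R) R → θ x = 0 := fun x hx => image_eq_zero_of_notMem_tsupport fun h => hx (hs h)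
  have hd : ∀ x, HasDerivAt (fun z => ∫ y in (-R)..z, θ y) (θ x) x := fun x =>
    (hθ.continuous.integral_hasStrictDerivAt (-R) x).hasDerivAt
  have hder : deriv (fun z => ∫ y in (-R)..z, θ y) = θ := funext fun x => (hd x).deriv
  refine ⟨fun z => ∫ y in (-R)..z, θ y, ?_, ?_, hder⟩
  · rw [contDiff_infty_iff_deriv, hder]
    exact ⟨fun x => (hd x).differentiableAt, hθ⟩
  · refine HasCompactSupport.intro (K := Icc (-R) R) isCompact_Icc fun x hx => ?_
    rcases lt_or_ge x (-R) with h | h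
    · have : ∀ y ∈ uIcc (-R) x, θ y = 0 := fun y hy => hz y fun hy' => by
        rw [uIcc_of_ge h.le] at hy
        exact absurd hy'.1 (not_lt.2 hy.2)
      rw [intervalIntegral.integral_congr (g := fun _ => 0) this]
      simp
    · have hx' : R < x := by
        by_contra h'
        exact hx ⟨h, not_lt.1 h'⟩
      rw [intervalIntegral.integral_eq_integral_of_support_subset, h0]
      intro y hy
      have := hs (subset_tsupport _ hy)
      exact ⟨this.1, this.2.le.trans hx'.le⟩

/-- A function with zero weak derivative is almost everywhere constant. -/
theorem ae_eq_const_of_integral_mul_deriv_eq_zero {D : ℝ → ℝ} (hD : LocallyIntegrable D)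
    (h : ∀ φ : ℝ → ℝ, ContDiff ℝ ∞ φ → HasCompactSupport φ → ∫ x, D x * deriv φ x = 0) :
    ∃ c, D =ᵐ[volume] fun _ => c := by
  let B : ContDiffBump (0 : ℝ) := ⟨1, 2, by norm_num, by norm_num⟩
  set ρ : ℝ → ℝ := B.normed volume
  have hρ : ContDiff ℝ ∞ ρ := B.contDiff_normed
  have hρc : HasCompactSupport ρ := B.hasCompactSupport_normed
  have hρ1 : ∫ x, ρ x = 1 := B.integral_normed
  have hint : ∀ ψ : ℝ → ℝ, ContDiff ℝ ∞ ψ → HasCompactSupport ψ →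
      Integrable fun x => D x * ψ x := fun ψ hψ hψc => by
    simpa [mul_comm] using hD.integrable_smul_left_of_hasCompactSupport hψ.continuous hψc
  refine ⟨∫ x, D x * ρ x, ae_eq_of_integral_contDiff_smul_eq hD
    (locallyIntegrable_const _) fun ψ hψ hψc => ?_⟩
  have hψi : Integrable ψ := hψ.continuous.integrable_of_hasCompactSupport hψc
  have hρi : Integrable ρ := hρ.continuous.integrable_of_hasCompactSupport hρc
  -- Subtracting `(∫ ψ) ρ` leaves mean zero, hence the derivative of a test function. Thus `∫ D ψ =
  -- (∫ D ρ)(∫ ψ)`, which forces the constant `∫ D ρ`.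
  obtain ⟨φ, hφ, hφc, hφd⟩ := exists_primitive_hasCompactSupport
    (θ := fun x => ψ x - (∫ y, ψ y) * ρ x) (hψ.sub (contDiff_const.mul hρ))
    (hψc.sub hρc.mul_left)
    (by rw [integral_sub hψi (hρi.const_mul _), integral_const_mul, hρ1, mul_one, sub_self])
  have h1 := h φ hφ hφc
  rw [hφd] at h1
  have h2 : ∀ x, D x * (ψ x - (∫ y, ψ y) * ρ x) = D x * ψ x - (∫ y, ψ y) * (D x * ρ x) :=
    fun x => by ring
  simp only [h2] at h1
  rw [integral_sub (hint ψ hψ hψc) ((hint ρ hρ hρc).const_mul _), integral_const_mul] at h1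
  simp only [smul_eq_mul]
  rw [integral_mul_const]
  simp only [mul_comm (ψ _)]
  linarith

/-- A function with a weak derivative has a continuous representative, which is a primitive. -/
theorem HasWeakDeriv.exists_continuous_primitive {f g : ℝ → ℝ} (h : HasWeakDeriv f g) :
    ∃ F : ℝ → ℝ, Continuous F ∧ F =ᵐ[volume] f ∧ ∀ a b, F b - F a = ∫ y in a..b, g y := by
  have hgi := fun a b => LocallyIntegrable.intervalIntegrable' h.2.1 a b
  set P : ℝ → ℝ := fun z => ∫ y in (0 : ℝ)..z, g y
  have hPc : Continuous P := intervalIntegral.continuous_primitive hgi 0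
  have hP : ∀ a b, P b - P a = ∫ y in a..b, g y := fun a b =>
    intervalIntegral.integral_interval_sub_left (hgi 0 b) (hgi 0 a)
  have hPw := hasWeakDeriv_of_primitive hPc h.2.1 hP
  obtain ⟨c, hc⟩ := ae_eq_const_of_integral_mul_deriv_eq_zero (D := fun x => f x - P x)
    (h.1.sub hPw.1) fun φ hφ hφc => by
      have hd : Continuous (deriv φ) := hφ.continuous_deriv (by simp)
      have hint : ∀ D : ℝ → ℝ, LocallyIntegrable D → Integrable fun x => D x * deriv φ x :=
        fun D hD => by
          simpa [mul_comm] using hD.integrable_smul_left_of_hasCompactSupport hd hφc.deriv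
      simp only [sub_mul]
      rw [integral_sub (hint f h.1) (hint P hPw.1), h.2.2 φ hφ hφc, hPw.2.2 φ hφ hφc, sub_self]
  refine ⟨fun x => P x + c, by fun_prop, ?_, fun a b => by rw [← hP a b]; ring⟩
  filter_upwards [hc] with x hx
  linarith

/-- A continuous integrable primitive is bounded by the `L¹` norm of its derivative. -/
theorem abs_le_integral_abs_of_primitive {F k : ℝ → ℝ} (hF : Integrable F) (hk : Integrable k)
    (hFk : ∀ a b, F b - F a = ∫ y in a..b, k y) (x : ℝ) : |F x| ≤ ∫ y, |k y| := by
  by_contra! hlt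
  -- The oscillation of `F` is at most `∫ |k|`, so a larger value anywhere keeps `|F| ≥ δ > 0` on
  -- the whole line, against integrability.
  set δ := |F x| - ∫ y, |k y|
  have hδ : 0 < δ := sub_pos.2 hlt
  have hle : ∀ y, δ ≤ |F y| := by
    intro y
    have h1 : |F x - F y| ≤ ∫ z, |k z| := by
      rw [hFk]
      refine (intervalIntegral.norm_integral_le_integral_norm_uIoc (f := k)).trans ?_
      exact setIntegral_le_integral hk.norm (Eventually.of_forall fun _ => norm_nonneg _)
    have h2 := abs_sub_abs_le_abs_sub (F x) (F y)
    simp only [δ]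
    linarith
  have : Integrable (fun _ : ℝ => δ) := hF.norm.mono' aestronglyMeasurable_const
    (Eventually.of_forall fun y => by
      rw [Real.norm_eq_abs, abs_of_pos hδ]; exact hle y)
  rw [integrable_const_iff] at this
  simp [hδ.ne', isFiniteMeasure_iff] at this

/-- Weak derivatives agree almost everywhere, so a single derivative serves both `W^{1,1}` and
`W^{1,p}`. A measurable version is taken because its translates must be jointly measurable in time
and space. -/
theorem exists_continuous_rep {p : ℝ} {u : ℝ → ℝ} (h : MemW1Wp p u) :
    ∃ F k : ℝ → ℝ, Continuous F ∧ F =ᵐ[volume] u ∧ Measurable k ∧ MemLp k 1 ∧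
      MemLp k (ENNReal.ofReal p) ∧ (∀ a b, F b - F a = ∫ y in a..b, k y) ∧
      eLpNorm k 1 volume ≤ normW1Wp p u ∧ eLpNorm u 1 volume ≤ normW1Wp p u := by
  obtain ⟨⟨hu1, g, hg, hg1⟩, ⟨hup, g', hg', hgp⟩⟩ := h
  obtain ⟨F, hFc, hFu, hF⟩ := hg.exists_continuous_primitive
  have hk : hg1.1.mk g =ᵐ[volume] g := hg1.1.ae_eq_mk.symm
  refine ⟨F, hg1.1.mk g, hFc, hFu, hg1.1.stronglyMeasurable_mk.measurable,
    hg1.ae_eq hk.symm, hgp.ae_eq ((hg'.ae_eq hg).trans hk.symm), fun a b => ?_, ?_, ?_⟩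
  · rw [hF]
    refine intervalIntegral.integral_congr_ae ?_
    filter_upwards [hk] with x hx _
    exact hx.symm
  · refine le_trans ?_ le_self_add
    refine le_iInf₂ fun g₁ hg₁ => ?_
    rw [eLpNorm_congr_ae (hk.trans (hg.ae_eq hg₁))]
    exact le_add_self
  · refine le_trans ?_ le_self_add
    exact le_iInf₂ fun g₁ hg₁ => le_self_add

/-! ### Minkowski's inequality, translations and curves in `L^q` -/

/-- Minkowski's inequality for an integral over an interval. -/
theorem eLpNorm_intervalIntegral_le {F : ℝ → ℝ → ℝ} (hF : Measurable (Function.uncurry F))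
    {q : ℝ≥0∞} (hq : 1 ≤ q) (hq' : q ≠ ⊤) {a b : ℝ} {C : ℝ≥0∞}
    (hC : ∀ s ∈ uIcc a b, eLpNorm (F s) q volume ≤ C) :
    eLpNorm (fun x => ∫ s in a..b, F s x) q volume ≤ ENNReal.ofReal |b - a| * C := by
  have hq0 : q ≠ 0 := (zero_lt_one.trans_le hq).ne'
  set r := q.toReal with hr
  have hr0 : 0 < r := ENNReal.toReal_pos hq0 hq'
  set μ : Measure ℝ := volume.restrict (uIoc a b)
  have hμ : μ univ = ENNReal.ofReal |b - a| := by
    simp only [μ, Measure.restrict_apply_univ, uIoc, Real.volume_Ioc]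
    rw [max_sub_min_eq_abs']
    rw [abs_sub_comm]
  set m := ENNReal.ofReal |b - a|
  have hFx : ∀ x, Measurable fun s => F s x := fun x => hF.comp measurable_prodMk_right
  -- Since the bound `C` is uniform in `s`, Hölder in `s` followed by Tonelli suffices.
  have hpt : ∀ x, ‖∫ s in a..b, F s x‖ₑ ^ r ≤ (∫⁻ s, ‖F s x‖ₑ ^ r ∂μ) * m ^ (r - 1) := by
    intro x
    have h1 : ‖∫ s in a..b, F s x‖ₑ ≤ eLpNorm (fun s => F s x) 1 μ := by
      rw [eLpNorm_one_eq_lintegral_enorm, intervalIntegral.intervalIntegral_eq_integral_uIoc,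
        enorm_smul]
      have : ‖(if a ≤ b then (1 : ℝ) else -1)‖ₑ = 1 := by split_ifs <;> simp
      rw [this, one_mul]
      exact enorm_integral_le_lintegral_enorm _
    have h2 := eLpNorm_le_eLpNorm_mul_rpow_measure_univ (μ := μ) hq
      (hFx x).aestronglyMeasurable
    have h3 := ENNReal.rpow_le_rpow (h1.trans h2) hr0.le
    refine h3.trans (le_of_eq ?_)
    rw [ENNReal.mul_rpow_of_nonneg _ _ hr0.le, hμ, eLpNorm_eq_lintegral_rpow_enorm_toReal hq0 hq',
      ← ENNReal.rpow_mul, ← ENNReal.rpow_mul, ← hr, ENNReal.toReal_one, one_div_mul_cancel hr0.ne',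
      ENNReal.rpow_one]
    congr 2
    field_simp
  rw [eLpNorm_eq_lintegral_rpow_enorm_toReal hq0 hq', ← hr, ← ENNReal.rpow_le_rpow_iff hr0,
    ← ENNReal.rpow_mul, one_div_mul_cancel hr0.ne', ENNReal.rpow_one]
  have hmeas : Measurable (Function.uncurry fun x s => ‖F s x‖ₑ ^ r) :=
    ((hF.comp measurable_swap).enorm).pow_const r
  calc ∫⁻ x, ‖∫ s in a..b, F s x‖ₑ ^ r ≤ ∫⁻ x, (∫⁻ s, ‖F s x‖ₑ ^ r ∂μ) * m ^ (r - 1) :=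
        lintegral_mono hpt
    _ = (∫⁻ s, (∫⁻ x, ‖F s x‖ₑ ^ r) ∂μ) * m ^ (r - 1) := by
        rw [lintegral_mul_const _ hmeas.lintegral_prod_right, lintegral_lintegral_swap
          hmeas.aemeasurable]
    _ ≤ (∫⁻ _, C ^ r ∂μ) * m ^ (r - 1) := by
        gcongr ?_ * _
        refine lintegral_mono_ae ?_
        filter_upwards [ae_restrict_mem measurableSet_uIoc] with s hs
        have h := ENNReal.rpow_le_rpow (hC s (uIoc_subset_uIcc hs)) hr0.le
        rwa [eLpNorm_eq_lintegral_rpow_enorm_toReal hq0 hq', ← ENNReal.rpow_mul, ← hr,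
          one_div_mul_cancel hr0.ne', ENNReal.rpow_one] at h
    _ = (m * C) ^ r := by
        rw [lintegral_const, hμ, ENNReal.mul_rpow_of_nonneg _ _ hr0.le]
        rcases eq_or_ne m 0 with h0 | h0
        · simp [h0, hr0]
        · have h1 : m * m ^ (r - 1) = m ^ r := by
            conv_lhs => rw [← ENNReal.rpow_one m, ← ENNReal.rpow_mul, one_mul,
              ← ENNReal.rpow_add _ _ h0 ENNReal.ofReal_ne_top, add_sub_cancel]
          rw [mul_assoc, h1, mul_comm]

/-- Translations are continuous in `L^q`. -/
theorem tendsto_eLpNorm_translate_sub {q : ℝ≥0∞} (hq : 1 ≤ q) (hq' : q ≠ ⊤) {f : ℝ → ℝ}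
    (hf : MemLp f q) : Tendsto (fun h => eLpNorm (fun x => f (x + h) - f x) q volume) (𝓝 0) (𝓝 0) := by
  have : Fact (1 ≤ q) := ⟨hq⟩
  let G : C(ℝ, C(ℝ, ℝ)) := ContinuousMap.curry ⟨fun z : ℝ × ℝ => z.2 + z.1, by fun_prop⟩
  have hG : ∀ h, MeasurePreserving (G h) volume volume := fun h =>
    measurePreserving_add_right volume h
  have hc : Continuous fun h => Lp.compMeasurePreserving (G h) (hG h) (hf.toLp f) :=
    continuous_const.compMeasurePreservingLp G.continuous hG hq'
  have ht := (hc.tendsto 0)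
  rw [tendsto_iff_edist_tendsto_0] at ht
  refine ht.congr fun h => ?_
  have h1 : ∀ h, Lp.compMeasurePreserving (G h) (hG h) (hf.toLp f)
      = (hf.comp_measurePreserving (hG h)).toLp (f ∘ G h) := fun h => rfl
  rw [h1, h1, Lp.edist_toLp_toLp]
  congr 1
  ext x
  simp [G]

theorem eLpNorm_translate {q : ℝ≥0∞} {f : ℝ → ℝ} (hf : AEStronglyMeasurable f) (h : ℝ) :
    eLpNorm (fun x => f (x + h)) q volume = eLpNorm f q volume :=
  eLpNorm_comp_measurePreserving hf (measurePreserving_add_right volume h)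

theorem memLp_translate {q : ℝ≥0∞} {f : ℝ → ℝ} (hf : MemLp f q) (h : ℝ) :
    MemLp (fun x => f (x + h)) q :=
  hf.comp_measurePreserving (measurePreserving_add_right volume h)

/-- `u ∈ C([0, ∞); L^q)`. -/
def ContinuousLq (q : ℝ≥0∞) (u : ℝ → ℝ → ℝ) : Prop :=
  ∀ t, 0 ≤ t → MemLp (u t) q ∧
    Tendsto (fun s => eLpNorm (fun x => u s x - u t x) q volume) (𝓝[Ici 0] t) (𝓝 0)

namespace ContinuousLq

variable {q : ℝ≥0∞} {u v : ℝ → ℝ → ℝ}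

theorem const {f : ℝ → ℝ} (hf : MemLp f q) : ContinuousLq q fun _ => f := fun t _ =>
  ⟨hf, by simpa using tendsto_const_nhds⟩

theorem add (hq : 1 ≤ q) (hu : ContinuousLq q u) (hv : ContinuousLq q v) :
    ContinuousLq q fun t x => u t x + v t x := fun t ht => by
  refine ⟨(hu t ht).1.add (hv t ht).1, ?_⟩
  have h := (hu t ht).2.add (hv t ht).2
  rw [add_zero] at h
  refine tendsto_of_tendsto_of_tendsto_of_le_of_le' tendsto_const_nhds h
    (Eventually.of_forall fun _ => zero_le) ?_
  filter_upwards [self_mem_nhdsWithin] with s hs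
  have h1 := ((hu s hs).1.sub (hu t ht).1).1
  have h2 := ((hv s hs).1.sub (hv t ht).1).1
  refine le_trans (le_of_eq ?_) (eLpNorm_add_le h1 h2 hq)
  congr 1
  ext x
  simp only [Pi.add_apply]
  ring

theorem smul (hq : 1 ≤ q) {a : ℝ → ℝ} (ha : Continuous a) (hu : ContinuousLq q u) :
    ContinuousLq q fun t x => a t * u t x := fun t ht => by
  refine ⟨(hu t ht).1.const_mul _, ?_⟩
  have ha1 : Tendsto (fun s => ‖a s‖ₑ) (𝓝[Ici 0] t) (𝓝 ‖a t‖ₑ) :=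
    ((continuous_enorm.comp ha).tendsto t).mono_left nhdsWithin_le_nhds
  have ha2 : Tendsto (fun s => ‖a s - a t‖ₑ) (𝓝[Ici 0] t) (𝓝 0) := by
    have : Continuous fun s => ‖a s - a t‖ₑ := continuous_enorm.comp (by fun_prop)
    have h := (this.tendsto t).mono_left (nhdsWithin_le_nhds (s := Ici 0))
    simpa using h
  have h1 := ENNReal.Tendsto.mul ha1 (Or.inr ENNReal.zero_ne_top) (hu t ht).2
    (Or.inr enorm_ne_top)
  have h2 := ENNReal.Tendsto.mul_const (b := eLpNorm (u t) q volume) ha2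
    (Or.inr (hu t ht).1.2.ne)
  have h := h1.add h2
  rw [mul_zero, zero_mul, add_zero] at h
  refine tendsto_of_tendsto_of_tendsto_of_le_of_le' tendsto_const_nhds h
    (Eventually.of_forall fun _ => zero_le) ?_
  filter_upwards [self_mem_nhdsWithin] with s hs
  have h3 := ((hu s hs).1.sub (hu t ht).1).const_mul (a s)
  have h4 := (hu t ht).1.const_mul (a s - a t)
  rw [← eLpNorm_const_smul, ← eLpNorm_const_smul]
  refine le_trans (le_of_eq ?_) (eLpNorm_add_le h3.1 h4.1 hq)
  congr 1
  ext x
  simp only [Pi.add_apply, Pi.smul_apply, smul_eq_mul]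
  ring

theorem const_mul (hq : 1 ≤ q) (c : ℝ) (hu : ContinuousLq q u) :
    ContinuousLq q fun t x => c * u t x := hu.smul hq (a := fun _ => c) continuous_const

/-- The difference splits into a translate of `u s - u t`, of the same norm, and a translation
increment of the fixed function `u t`. -/
theorem translate (hq : 1 ≤ q) (hq' : q ≠ ⊤) (hu : ContinuousLq q u) (c : ℝ) :
    ContinuousLq q fun t x => u t (x + c * t) := fun t ht => by
  refine ⟨memLp_translate (hu t ht).1 _, ?_⟩
  have h1 : Tendsto (fun s => eLpNorm (fun x => u t (x + (c * s - c * t)) - u t x) q volume)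
      (𝓝[Ici 0] t) (𝓝 0) := by
    refine (tendsto_eLpNorm_translate_sub hq hq' (hu t ht).1).comp ?_
    have : Continuous fun s : ℝ => c * s - c * t := by fun_prop
    have h := (this.tendsto t).mono_left (nhdsWithin_le_nhds (s := Ici 0))
    simpa using h
  have h := (hu t ht).2.add h1
  rw [add_zero] at h
  refine tendsto_of_tendsto_of_tendsto_of_le_of_le' tendsto_const_nhds h
    (Eventually.of_forall fun _ => zero_le) ?_
  filter_upwards [self_mem_nhdsWithin] with s hs
  have h3 : MemLp (fun x => u s x - u t x) q := (hu s hs).1.sub (hu t ht).1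
  have h4 : MemLp (fun x => u t (x + (c * s - c * t)) - u t x) q :=
    (memLp_translate (hu t ht).1 (c * s - c * t)).sub (hu t ht).1
  rw [← eLpNorm_translate (q := q) h3.1 (c * s), ← eLpNorm_translate (q := q) h4.1 (c * t)]
  refine le_trans (le_of_eq ?_) (eLpNorm_add_le (memLp_translate h3 _).1 (memLp_translate h4 _).1 hq)
  congr 1
  ext x
  simp only [Pi.add_apply]
  rw [show x + c * t + (c * s - c * t) = x + c * s by ring]
  ring

theorem eventually_le (hq : 1 ≤ q) (hu : ContinuousLq q u) {t : ℝ} (ht : 0 ≤ t) :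
    ∀ᶠ s in 𝓝[Ici 0] t, eLpNorm (u s) q volume ≤ 1 + eLpNorm (u t) q volume := by
  filter_upwards [self_mem_nhdsWithin, (hu t ht).2.eventually_le_const zero_lt_one] with s hs hs'
  have h := eLpNorm_add_le ((hu s hs).1.sub (hu t ht).1).1 (hu t ht).1.1 hq
  rw [sub_add_cancel] at h
  exact h.trans (by gcongr; exact hs')

/-- A curve in `L^q` is locally bounded if it is continuous. -/
theorem exists_bound (hq : 1 ≤ q) (hu : ContinuousLq q u) (T : ℝ) :
    ∃ C : ℝ≥0∞, C ≠ ⊤ ∧ ∀ t ∈ Icc 0 T, eLpNorm (u t) q volume ≤ C := by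
  refine isCompact_Icc.induction_on
    (p := fun A => ∃ C : ℝ≥0∞, C ≠ ⊤ ∧ ∀ t ∈ A, eLpNorm (u t) q volume ≤ C)
    ⟨0, by simp, by simp⟩ ?_ ?_ ?_
  · rintro A B hAB ⟨C, hC, h⟩
    exact ⟨C, hC, fun t ht => h t (hAB ht)⟩
  · rintro A B ⟨C, hC, h⟩ ⟨D, hD, h'⟩
    refine ⟨max C D, (max_lt hC.lt_top hD.lt_top).ne, fun t ht => ?_⟩
    rcases ht with ht | ht
    · exact (h t ht).trans (le_max_left _ _)
    · exact (h' t ht).trans (le_max_right _ _)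
  · intro t ht
    refine ⟨_, nhdsWithin_mono t Icc_subset_Ici_self (hu.eventually_le hq ht.1),
      1 + eLpNorm (u t) q volume, ?_, fun s hs => hs⟩
    exact ENNReal.add_ne_top.2 ⟨by simp, (hu t ht.1).1.2.ne⟩

end ContinuousLq

/-- A curve with locally bounded time derivative is continuous. -/
theorem continuousLq_of_integral {q : ℝ≥0∞} (hq : 1 ≤ q) (hq' : q ≠ ⊤) {w m : ℝ → ℝ → ℝ}
    (hm : Measurable (Function.uncurry m))
    (hb : ∀ T, ∃ C : ℝ≥0∞, C ≠ ⊤ ∧ ∀ t ∈ Icc 0 T, eLpNorm (m t) q volume ≤ C)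
    (hw : ∀ t, 0 ≤ t → MemLp (w t) q)
    (hwm : ∀ t, 0 ≤ t → ∀ s, 0 ≤ s → ∀ x, w s x - w t x = ∫ τ in t..s, m τ x) :
    ContinuousLq q w := fun t ht => by
  refine ⟨hw t ht, ?_⟩
  obtain ⟨C, hC, hCm⟩ := hb (t + 1)
  have h1 : Tendsto (fun s => ENNReal.ofReal |s - t| * C) (𝓝[Ici 0] t) (𝓝 0) := by
    have : Continuous fun s => ENNReal.ofReal |s - t| :=
      ENNReal.continuous_ofReal.comp (by fun_prop)
    have h := ENNReal.Tendsto.mul_const (b := C)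
      ((this.tendsto t).mono_left (nhdsWithin_le_nhds (s := Ici 0))) (Or.inr hC)
    simpa using h
  refine tendsto_of_tendsto_of_tendsto_of_le_of_le' tendsto_const_nhds h1
    (Eventually.of_forall fun _ => zero_le) ?_
  filter_upwards [self_mem_nhdsWithin, nhdsWithin_le_nhds (Iic_mem_nhds (lt_add_one t))] with s hs hs'
  simp only [hwm t ht s hs]
  refine eLpNorm_intervalIntegral_le hm hq hq' fun τ hτ => hCm τ ?_
  refine ⟨(le_inf ht hs).trans hτ.1, hτ.2.trans (sup_le (by linarith) hs')⟩

/-- A curve with continuous time derivative is differentiable. -/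
theorem tendsto_slope_of_integral {q : ℝ≥0∞} (hq : 1 ≤ q) (hq' : q ≠ ⊤) {w m : ℝ → ℝ → ℝ}
    (hm : Measurable (Function.uncurry m)) (hmc : ContinuousLq q m)
    (hmi : ∀ x a b, IntervalIntegrable (fun τ => m τ x) volume a b)
    (hwm : ∀ t, 0 ≤ t → ∀ s, 0 ≤ s → ∀ x, w s x - w t x = ∫ τ in t..s, m τ x)
    {t : ℝ} (ht : 0 ≤ t) :
    Tendsto (fun s => eLpNorm (fun x => (s - t)⁻¹ * (w s x - w t x) - m t x) q volume)
      (𝓝[Ici 0 \ {t}] t) (𝓝 0) := by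
  rw [ENNReal.tendsto_nhds_zero]
  intro ε hε
  have h := (hmc t ht).2.eventually_le_const hε
  obtain ⟨δ, hδ, hδs⟩ := Metric.mem_nhdsWithin_iff.1 h
  have hball : Metric.ball t δ ∈ 𝓝[Ici 0 \ {t}] t :=
    nhdsWithin_le_nhds (Metric.ball_mem_nhds t hδ)
  filter_upwards [self_mem_nhdsWithin, hball] with s hs hsδ
  have hst : s - t ≠ 0 := sub_ne_zero.2 hs.2
  have heq : ∀ x, (s - t)⁻¹ * (w s x - w t x) - m t x
      = (s - t)⁻¹ * ∫ τ in t..s, (m τ x - m t x) := by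
    intro x
    rw [hwm t ht s hs.1, intervalIntegral.integral_sub (hmi x t s)
      (intervalIntegrable_const), intervalIntegral.integral_const, smul_eq_mul]
    field_simp
  simp only [heq]
  have hmeas : Measurable (Function.uncurry fun τ x => m τ x - m t x) :=
    hm.sub ((hm.comp measurable_prodMk_left).comp measurable_snd)
  have h2 := eLpNorm_intervalIntegral_le hmeas hq hq' (a := t) (b := s) (C := ε) fun τ hτ => by
    have hmem : τ ∈ Metric.ball t δ ∩ Ici 0 := by
      refine ⟨?_, (le_inf ht hs.1).trans hτ.1⟩
      rw [Metric.mem_ball, Real.dist_eq] at hsδ ⊢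
      exact (abs_sub_left_of_mem_uIcc hτ).trans_lt hsδ
    exact hδs hmem
  have h3 : eLpNorm (fun x => (s - t)⁻¹ * ∫ τ in t..s, (m τ x - m t x)) q volume
      = ‖(s - t)⁻¹‖ₑ * eLpNorm (fun x => ∫ τ in t..s, (m τ x - m t x)) q volume :=
    eLpNorm_const_smul (s - t)⁻¹ (fun x => ∫ τ in t..s, (m τ x - m t x)) q volume
  rw [h3]
  calc _ ≤ ‖(s - t)⁻¹‖ₑ * (ENNReal.ofReal |s - t| * ε) := by gcongr
    _ = ε := by
      rw [← mul_assoc, ← Real.norm_eq_abs, ofReal_norm, ← enorm_mul,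
        inv_mul_cancel₀ hst, enorm_one, one_mul]

/-! ### D'Alembert's formula along characteristics -/

theorem integral_comp_add_sub_integral_comp_sub {k : ℝ → ℝ}
    (hk : ∀ a b, IntervalIntegrable k volume a b) (c d : ℝ) (a b t : ℝ) :
    ∫ x in a..b, (c * k (x + t) + d * k (x - t))
      = c * (∫ x in (a + t)..(b + t), k x) + d * ∫ x in (a - t)..(b - t), k x := by
  have h1 : IntervalIntegrable (fun y => k (y + t)) volume a b := by
    simpa using (hk (a + t) (b + t)).comp_add_right t
  have h2 : IntervalIntegrable (fun y => k (y - t)) volume a b := by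
    simpa using (hk (a - t) (b - t)).comp_sub_right t
  rw [intervalIntegral.integral_add (h1.const_mul _) (h2.const_mul _),
    intervalIntegral.integral_const_mul, intervalIntegral.integral_const_mul,
    intervalIntegral.integral_comp_add_right (fun z => k z),
    intervalIntegral.integral_comp_sub_right (fun z => k z)]

theorem avgOp_sub_avgOp {f k : ℝ → ℝ} (hk : ∀ a b, IntervalIntegrable k volume a b)
    (hfk : ∀ a b, f b - f a = ∫ y in a..b, k y) (t a b : ℝ) :
    avgOp t f b - avgOp t f a = ∫ x in a..b, (1 / 2 * k (x + t) + 1 / 2 * k (x - t)) := by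
  rw [integral_comp_add_sub_integral_comp_sub hk, ← hfk, ← hfk, avgOp, avgOp]
  ring

theorem avgOp_eq_add_integral {f k : ℝ → ℝ} (hk : ∀ a b, IntervalIntegrable k volume a b)
    (hfk : ∀ a b, f b - f a = ∫ y in a..b, k y) (t x : ℝ) :
    avgOp t f x = f x + ∫ τ in (0 : ℝ)..t, (1 / 2 * k (x + τ) + -1 / 2 * k (x - τ)) := by
  rw [intervalIntegral.integral_add ((intervalIntegrable_comp_add hk x _ _).const_mul _)
    ((intervalIntegrable_comp_sub hk x _ _).const_mul _), intervalIntegral.integral_const_mul,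
    intervalIntegral.integral_const_mul, intervalIntegral.integral_comp_add_left (fun z => k z),
    intervalIntegral.integral_comp_sub_left (fun z => k z), ← hfk, ← hfk, avgOp, add_zero, sub_zero]
  ring

theorem waveOp_sub_waveOp {f : ℝ → ℝ} (hf : ∀ a b, IntervalIntegrable f volume a b) (t a b : ℝ) :
    waveOp t f b - waveOp t f a = ∫ x in a..b, (1 / 2 * f (x + t) + -1 / 2 * f (x - t)) := by
  have hP : ∀ a b, (∫ y in (0 : ℝ)..b, f y) - (∫ y in (0 : ℝ)..a, f y) = ∫ y in a..b, f y :=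
    fun a b => intervalIntegral.integral_interval_sub_left (hf 0 b) (hf 0 a)
  rw [integral_comp_add_sub_integral_comp_sub hf, ← hP (a + t), ← hP (a - t), waveOp_eq_of_primitive hP,
    waveOp_eq_of_primitive hP]
  ring

/-- The integral of a source term along the characteristics of speed `-ε`. -/
noncomputable def charIntegral (H : ℝ → ℝ → ℝ) (ε t x : ℝ) : ℝ :=
  ∫ σ in (0 : ℝ)..t, H σ (x + ε * (t - σ))

section source

variable {H : ℝ → ℝ → ℝ}

theorem continuous_charIntegral (hH : Continuous (Function.uncurry H)) (ε : ℝ) :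
    Continuous (Function.uncurry (charIntegral H ε)) := by
  have : Continuous (Function.uncurry fun (z : ℝ × ℝ) σ => H σ (z.2 + ε * (z.1 - σ))) :=
    hH.comp (by fun_prop : Continuous fun q : (ℝ × ℝ) × ℝ => (q.2, q.1.2 + ε * (q.1.1 - q.2)))
  exact continuous_intervalIntegral_of_continuous this continuous_const continuous_fst

theorem integral_char_eq (hH : Continuous (Function.uncurry H)) (c d t x : ℝ) :
    ∫ σ in (0 : ℝ)..t, (c * H σ (x + (t - σ)) + d * H σ (x - (t - σ)))
      = c * charIntegral H 1 t x + d * charIntegral H (-1) t x := by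
  rw [intervalIntegral.integral_add (Continuous.intervalIntegrable (by fun_prop) _ _)
    (Continuous.intervalIntegrable (by fun_prop) _ _), intervalIntegral.integral_const_mul,
    intervalIntegral.integral_const_mul, charIntegral, charIntegral]
  simp only [one_mul, neg_one_mul, ← sub_eq_add_neg]

/-- `waveOp` is the time integral of `avgOp`; exchanging the order over the triangle exhibits the
time derivative of the source term as a mean of the two characteristic integrals. -/
theorem integral_waveOp_eq_integral_charIntegral (hH : Continuous (Function.uncurry H)) {t : ℝ}
    (ht : 0 ≤ t) (x : ℝ) :
    ∫ σ in (0 : ℝ)..t, waveOp (t - σ) (H σ) x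
      = ∫ τ in (0 : ℝ)..t, (1 / 2 * charIntegral H 1 τ x + 1 / 2 * charIntegral H (-1) τ x) := by
  have h1 : ∀ τ, 1 / 2 * charIntegral H 1 τ x + 1 / 2 * charIntegral H (-1) τ x
      = ∫ σ in (0 : ℝ)..τ, avgOp (τ - σ) (H σ) x := by
    intro τ
    rw [← integral_char_eq hH]
    refine intervalIntegral.integral_congr fun σ _ => ?_
    simp only [avgOp]
    ring
  have hc : Continuous (Function.uncurry fun τ σ => avgOp (τ - σ) (H σ) x) :=
    continuous_avgOp (f := fun z : ℝ × ℝ => H z.2) (by fun_prop) (by fun_prop) (by fun_prop)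
  simp only [h1]
  rw [integral_triangle_swap hc ht]
  refine intervalIntegral.integral_congr fun σ _ => ?_
  have hσ : Continuous (H σ) := by fun_prop
  have h2 := intervalIntegral.integral_comp_sub_right (a := σ) (b := t)
    (fun r => avgOp r (H σ) x) σ
  rw [sub_self] at h2
  rw [waveOp_eq_integral_avgOp fun a b => hσ.intervalIntegrable a b, ← h2]

theorem integral_waveOp_sub (hH : Continuous (Function.uncurry H)) (t a b : ℝ) :
    (∫ σ in (0 : ℝ)..t, waveOp (t - σ) (H σ) b) - (∫ σ in (0 : ℝ)..t, waveOp (t - σ) (H σ) a)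
      = ∫ x in a..b, (1 / 2 * charIntegral H 1 t x + -1 / 2 * charIntegral H (-1) t x) := by
  have hw : ∀ x, Continuous fun σ => waveOp (t - σ) (H σ) x := fun x =>
    continuous_waveOp (f := fun σ : ℝ => H σ) hH (by fun_prop) (by fun_prop)
  rw [← intervalIntegral.integral_sub ((hw b).intervalIntegrable _ _)
    ((hw a).intervalIntegrable _ _)]
  simp only [← integral_char_eq hH]
  rw [integral_swap_of_continuous (by fun_prop)]
  refine intervalIntegral.integral_congr fun σ _ => ?_
  have hσ : Continuous (H σ) := by fun_prop
  exact waveOp_sub_waveOp (fun a b => hσ.intervalIntegrable a b) _ _ _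

/-- In the moving coordinate `ξ = x + ε t` the time `t` occurs only as the upper limit of
integration, so local boundedness of `H` in `L^q` gives continuity; translating back preserves it.
-/
theorem continuousLq_charIntegral {q : ℝ≥0∞} (hq : 1 ≤ q) (hq' : q ≠ ⊤)
    (hH : Continuous (Function.uncurry H))
    (hb : ∀ T, ∃ C : ℝ≥0∞, C ≠ ⊤ ∧ ∀ t ∈ Icc 0 T, eLpNorm (H t) q volume ≤ C) (ε : ℝ) :
    ContinuousLq q (charIntegral H ε) := by
  have hm : Continuous (Function.uncurry fun τ ξ => H τ (ξ - ε * τ)) :=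
    hH.comp (by fun_prop : Continuous fun z : ℝ × ℝ => (z.1, z.2 - ε * z.1))
  have hmb : ∀ T, ∃ C : ℝ≥0∞, C ≠ ⊤ ∧ ∀ t ∈ Icc 0 T,
      eLpNorm (fun ξ => H t (ξ - ε * t)) q volume ≤ C := by
    intro T
    obtain ⟨C, hC, hCH⟩ := hb T
    refine ⟨C, hC, fun t ht => ?_⟩
    have hc : Continuous (H t) := by fun_prop
    simp only [sub_eq_add_neg]
    rw [eLpNorm_translate hc.aestronglyMeasurable]
    exact hCH t ht
  have h : ContinuousLq q fun t ξ => ∫ τ in (0 : ℝ)..t, H τ (ξ - ε * τ) := by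
    refine continuousLq_of_integral hq hq' hm.measurable hmb (fun t ht => ⟨?_, ?_⟩)
      fun t _ s _ x => ?_
    · exact (continuous_intervalIntegral_of_continuous (f := fun ξ τ => H τ (ξ - ε * τ))
        (hm.comp continuous_swap) continuous_const continuous_const).aestronglyMeasurable
    · obtain ⟨C, hC, hCm⟩ := hmb t
      refine (eLpNorm_intervalIntegral_le hm.measurable hq hq' (C := C) fun s hs => ?_).trans_lt
        (ENNReal.mul_lt_top ENNReal.ofReal_lt_top hC.lt_top)
      rw [uIcc_of_le ht] at hs
      exact hCm s hs
    · exact intervalIntegral.integral_interval_sub_left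
        (Continuous.intervalIntegrable (by fun_prop) _ _)
        (Continuous.intervalIntegrable (by fun_prop) _ _)
  have h2 := h.translate hq hq' ε
  have : (fun t x => ∫ τ in (0 : ℝ)..t, H τ (x + ε * t - ε * τ)) = charIntegral H ε := by
    ext t x
    refine intervalIntegral.integral_congr fun τ _ => ?_
    congr 1
    ring
  rwa [← this]

end source

/-- The derivative of a solution of the wave equation along the characteristics of speed `ε`, for
the initial data `f₀' = k`, `f₁` and the source term `H`. -/
noncomputable def charDeriv (k f₁ : ℝ → ℝ) (H : ℝ → ℝ → ℝ) (ε t x : ℝ) : ℝ :=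
  ε * k (x + ε * t) + f₁ (x + ε * t) + charIntegral H ε t x

section charDeriv

variable {k f₁ : ℝ → ℝ} {H : ℝ → ℝ → ℝ}

theorem measurable_charDeriv (hk : Measurable k) (hf₁ : Measurable f₁)
    (hH : Continuous (Function.uncurry H)) (ε : ℝ) :
    Measurable (Function.uncurry (charDeriv k f₁ H ε)) := by
  have h1 : Measurable fun z : ℝ × ℝ => z.2 + ε * z.1 := by fun_prop
  exact (((hk.comp h1).const_mul ε).add (hf₁.comp h1)).add (continuous_charIntegral hH ε).measurable

theorem continuousLq_charDeriv {q : ℝ≥0∞} (hq : 1 ≤ q) (hq' : q ≠ ⊤) (hk : MemLp k q)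
    (hf₁ : MemLp f₁ q) (hH : Continuous (Function.uncurry H))
    (hb : ∀ T, ∃ C : ℝ≥0∞, C ≠ ⊤ ∧ ∀ t ∈ Icc 0 T, eLpNorm (H t) q volume ≤ C) (ε : ℝ) :
    ContinuousLq q (charDeriv k f₁ H ε) :=
  ((((ContinuousLq.const hk).translate hq hq' ε).const_mul hq ε).add hq
    ((ContinuousLq.const hf₁).translate hq hq' ε)).add hq (continuousLq_charIntegral hq hq' hH hb ε)

theorem intervalIntegrable_charDeriv_time (hk : ∀ a b, IntervalIntegrable k volume a b)
    (hf₁ : ∀ a b, IntervalIntegrable f₁ volume a b) (hH : Continuous (Function.uncurry H))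
    {ε : ℝ} (hε : ε = 1 ∨ ε = -1) (x a b : ℝ) :
    IntervalIntegrable (fun τ => charDeriv k f₁ H ε τ x) volume a b := by
  have hc : Continuous fun τ => charIntegral H ε τ x :=
    (continuous_charIntegral hH ε).comp (by fun_prop : Continuous fun τ => (τ, x))
  have h : ∀ {g : ℝ → ℝ}, (∀ a b, IntervalIntegrable g volume a b) →
      IntervalIntegrable (fun τ => g (x + ε * τ)) volume a b := by
    intro g hg
    rcases hε with rfl | rfl
    · simpa using intervalIntegrable_comp_add hg x a b
    · simpa [← sub_eq_add_neg] using intervalIntegrable_comp_sub hg x a b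
  exact (((h hk).const_mul ε).add (h hf₁)).add (hc.intervalIntegrable _ _)

/-- Time integration of d'Alembert's formula. -/
theorem dAlembert_eq_add_integral {f₀ : ℝ → ℝ} (hk : ∀ a b, IntervalIntegrable k volume a b)
    (hf₁ : ∀ a b, IntervalIntegrable f₁ volume a b) (hH : Continuous (Function.uncurry H))
    (hf₀ : ∀ a b, f₀ b - f₀ a = ∫ y in a..b, k y) {t : ℝ} (ht : 0 ≤ t) (x : ℝ) :
    avgOp t f₀ x + waveOp t f₁ x + ∫ σ in (0 : ℝ)..t, waveOp (t - σ) (H σ) x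
      = f₀ x + ∫ τ in (0 : ℝ)..t,
        (1 / 2 * charDeriv k f₁ H 1 τ x + 1 / 2 * charDeriv k f₁ H (-1) τ x) := by
  have hc : ∀ ε, Continuous fun τ => charIntegral H ε τ x := fun ε =>
    (continuous_charIntegral hH ε).comp (by fun_prop : Continuous fun τ => (τ, x))
  have hp := fun {g : ℝ → ℝ} (hg : ∀ a b, IntervalIntegrable g volume a b) (c : ℝ) =>
    (intervalIntegrable_comp_add hg x 0 t).const_mul c
  have hm := fun {g : ℝ → ℝ} (hg : ∀ a b, IntervalIntegrable g volume a b) (c : ℝ) =>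
    (intervalIntegrable_comp_sub hg x 0 t).const_mul c
  rw [avgOp_eq_add_integral hk hf₀, waveOp_eq_integral_avgOp hf₁,
    integral_waveOp_eq_integral_charIntegral hH ht, add_assoc, add_assoc, ← add_assoc (∫ τ in 0..t, _)]
  have hav : ∀ σ, avgOp σ f₁ x = 1 / 2 * f₁ (x + σ) + 1 / 2 * f₁ (x - σ) := fun σ => by
    rw [avgOp]; ring
  simp only [hav]
  rw [← intervalIntegral.integral_add ((hp hk _).add (hm hk _)) ((hp hf₁ _).add (hm hf₁ _)),
    ← intervalIntegral.integral_add
      (((hp hk _).add (hm hk _)).add ((hp hf₁ _).add (hm hf₁ _)))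
      (Continuous.intervalIntegrable (by have := hc 1; have := hc (-1); fun_prop) _ _)]
  congr 1
  refine intervalIntegral.integral_congr fun τ _ => ?_
  simp only [charDeriv, one_mul, neg_one_mul, ← sub_eq_add_neg]
  ring

/-- Space integration of d'Alembert's formula. -/
theorem dAlembert_sub_eq_integral {f₀ : ℝ → ℝ} (hk : ∀ a b, IntervalIntegrable k volume a b)
    (hf₁ : ∀ a b, IntervalIntegrable f₁ volume a b) (hH : Continuous (Function.uncurry H))
    (hf₀ : ∀ a b, f₀ b - f₀ a = ∫ y in a..b, k y) (t a b : ℝ) :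
    (avgOp t f₀ b + waveOp t f₁ b + ∫ σ in (0 : ℝ)..t, waveOp (t - σ) (H σ) b)
      - (avgOp t f₀ a + waveOp t f₁ a + ∫ σ in (0 : ℝ)..t, waveOp (t - σ) (H σ) a)
      = ∫ x in a..b, (1 / 2 * charDeriv k f₁ H 1 t x + -1 / 2 * charDeriv k f₁ H (-1) t x) := by
  have hc : ∀ ε, Continuous fun x => charIntegral H ε t x := fun ε =>
    (continuous_charIntegral hH ε).comp (by fun_prop : Continuous fun x => (t, x))
  have hp : ∀ {g : ℝ → ℝ}, (∀ a b, IntervalIntegrable g volume a b) → ∀ c,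
      IntervalIntegrable (fun x => c * g (x + t)) volume a b := fun hg c => by
    simpa using ((hg (a + t) (b + t)).comp_add_right t).const_mul c
  have hm : ∀ {g : ℝ → ℝ}, (∀ a b, IntervalIntegrable g volume a b) → ∀ c,
      IntervalIntegrable (fun x => c * g (x - t)) volume a b := fun hg c => by
    simpa using ((hg (a - t) (b - t)).comp_sub_right t).const_mul c
  rw [add_sub_add_comm, add_sub_add_comm, avgOp_sub_avgOp hk hf₀, waveOp_sub_waveOp hf₁,
    integral_waveOp_sub hH,
    ← intervalIntegral.integral_add ((hp hk _).add (hm hk _)) ((hp hf₁ _).add (hm hf₁ _)),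
    ← intervalIntegral.integral_add
      (((hp hk _).add (hm hk _)).add ((hp hf₁ _).add (hm hf₁ _)))
      (Continuous.intervalIntegrable (by have := hc 1; have := hc (-1); fun_prop) _ _)]
  refine intervalIntegral.integral_congr fun τ _ => ?_
  simp only [charDeriv, one_mul, neg_one_mul, ← sub_eq_add_neg]
  ring

end charDeriv

/-! ### `L^q` bounds for the free Klein-Gordon evolution -/

section bounds

variable {q : ℝ≥0∞}

theorem eLpNorm_avgOp_le (hq : 1 ≤ q) {f : ℝ → ℝ} (hf : AEStronglyMeasurable f) (t : ℝ) :
    eLpNorm (avgOp t f) q volume ≤ eLpNorm f q volume := by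
  have h1 : AEStronglyMeasurable (fun x => f (x + t)) :=
    hf.comp_measurePreserving (measurePreserving_add_right volume t)
  have h2 : AEStronglyMeasurable (fun x => f (x + -t)) :=
    hf.comp_measurePreserving (measurePreserving_add_right volume (-t))
  have heq : avgOp t f = (1 / 2 : ℝ) • ((fun x => f (x + t)) + fun x => f (x + -t)) := by
    ext x
    simp [avgOp, ← sub_eq_add_neg]
  rw [heq, eLpNorm_const_smul]
  calc _ ≤ ‖(1 / 2 : ℝ)‖ₑ * (eLpNorm f q volume + eLpNorm f q volume) := by
        gcongr
        refine (eLpNorm_add_le h1 h2 hq).trans ?_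
        rw [eLpNorm_translate hf, eLpNorm_translate hf]
    _ = eLpNorm f q volume := by
        rw [← two_mul, ← mul_assoc]
        have : ‖(1 / 2 : ℝ)‖ₑ * 2 = 1 := by
          rw [show (2 : ℝ≥0∞) = ‖(2 : ℝ)‖ₑ by rw [Real.enorm_of_nonneg (by norm_num)]; simp,
            ← enorm_mul]
          norm_num
        rw [this, one_mul]

/-- On the cone the kernel is at most `R`, so Minkowski over translates gives `1/2 · 2t · R`. -/
theorem eLpNorm_kgOp_le (hq : 1 ≤ q) (hq' : q ≠ ⊤) {f : ℝ → ℝ} (hf : Measurable f) {t R : ℝ}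
    (ht : 0 ≤ t) (hR : ∀ r ∈ Icc 0 (t ^ 2), |riemannFun r| ≤ R) :
    eLpNorm (kgOp t f) q volume ≤ ENNReal.ofReal (t * R) * eLpNorm f q volume := by
  have hE := continuous_riemannFun.measurable
  have hR0 : 0 ≤ R := (abs_nonneg _).trans (hR 0 ⟨le_rfl, by positivity⟩)
  have hm : Measurable (Function.uncurry fun y x => riemannFun (t ^ 2 - y ^ 2) * f (x - y)) :=
    (hE.comp (by fun_prop : Measurable fun z : ℝ × ℝ => t ^ 2 - z.1 ^ 2)).mul
      (hf.comp (by fun_prop : Measurable fun z : ℝ × ℝ => z.2 - z.1))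
  have h := eLpNorm_intervalIntegral_le hm hq hq' (a := -t) (b := t)
    (C := ENNReal.ofReal R * eLpNorm f q volume) fun y hy => by
      rw [uIcc_of_le (by linarith)] at hy
      have h1 := eLpNorm_const_smul (riemannFun (t ^ 2 - y ^ 2)) (fun x => f (x + -y)) q volume
      rw [eLpNorm_translate hf.aestronglyMeasurable] at h1
      refine (le_of_eq h1).trans ?_
      gcongr
      rw [← ofReal_norm]
      refine ENNReal.ofReal_le_ofReal (hR _ ⟨?_, ?_⟩) <;> nlinarith [hy.1, hy.2]
  have heq : kgOp t f = (1 / 2 : ℝ) •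
      fun x => ∫ y in (-t)..t, riemannFun (t ^ 2 - y ^ 2) * f (x - y) := rfl
  rw [heq, eLpNorm_const_smul]
  refine (mul_le_mul_right h _).trans (le_of_eq ?_)
  rw [← mul_assoc, ← mul_assoc, Real.enorm_of_nonneg (by norm_num),
    ← ENNReal.ofReal_mul (by norm_num), ← ENNReal.ofReal_mul (by positivity), sub_neg_eq_add,
    abs_of_nonneg (by linarith)]
  congr 2
  ring

theorem stronglyMeasurable_kgOp {f : ℝ → ℝ} (hf : Measurable f) (t : ℝ) :
    StronglyMeasurable (kgOp t f) := by
  have hE := continuous_riemannFun.measurable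
  have hm : Measurable (Function.uncurry fun x y => riemannFun (t ^ 2 - y ^ 2) * f (x - y)) :=
    (hE.comp (by fun_prop : Measurable fun z : ℝ × ℝ => t ^ 2 - z.2 ^ 2)).mul
      (hf.comp (by fun_prop : Measurable fun z : ℝ × ℝ => z.1 - z.2))
  unfold kgOp
  simp only [intervalIntegral.intervalIntegral_eq_integral_uIoc, smul_eq_mul]
  exact (hm.stronglyMeasurable.integral_prod_right.const_mul _).const_mul _

/-- A crude bound on each `[0, T]` is enough: it only has to place the dominated solution in `L^q`,
locally uniformly in time. -/
theorem exists_bound_kgAvgOp_add_kgOp (hq : 1 ≤ q) (hq' : q ≠ ⊤) {f₀ f₁ : ℝ → ℝ}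
    (hf₀ : Continuous f₀) (hf₁ : Measurable f₁) (h₀ : MemLp f₀ q) (h₁ : MemLp f₁ q) (T : ℝ) :
    ∃ C : ℝ≥0∞, C ≠ ⊤ ∧ ∀ t ∈ Icc 0 T,
      eLpNorm (fun x => kgAvgOp t f₀ x + kgOp t f₁ x) q volume ≤ C := by
  obtain ⟨R, hR⟩ := (isCompact_Icc (a := (0 : ℝ)) (b := T ^ 2)).exists_bound_of_continuousOn
    continuous_riemannFun.continuousOn
  have hR0 : 0 ≤ R := (norm_nonneg _).trans (hR 0 ⟨le_rfl, by positivity⟩)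
  set N₀ := eLpNorm f₀ q volume
  set N₁ := eLpNorm f₁ q volume
  have hkg : ∀ {f : ℝ → ℝ}, Measurable f → ∀ t ∈ Icc 0 T,
      eLpNorm (kgOp t f) q volume ≤ ENNReal.ofReal (T * R) * eLpNorm f q volume := by
    intro f hf t ht
    refine (eLpNorm_kgOp_le hq hq' hf ht.1 (R := R) fun r hr => hR r
      ⟨hr.1, hr.2.trans (pow_le_pow_left₀ ht.1 ht.2 2)⟩).trans ?_
    gcongr
    exact ht.2
  refine ⟨N₀ + ‖(1 / 4 : ℝ)‖ₑ * (ENNReal.ofReal T * (ENNReal.ofReal (T * R) * N₀))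
    + ENNReal.ofReal (T * R) * N₁, ?_, fun t ht => ?_⟩
  · have h0 : N₀ ≠ ⊤ := h₀.2.ne
    have h1 : N₁ ≠ ⊤ := h₁.2.ne
    finiteness
  · have hk : Continuous (Function.uncurry fun σ x => kgOp (t - σ) (avgOp σ f₀) x) := by
      refine continuous_kgOp (f := fun z : ℝ × ℝ => avgOp z.1 f₀) ?_ (by fun_prop) (by fun_prop)
      exact continuous_avgOp (f := fun _ => f₀) (by fun_prop) (by fun_prop) (by fun_prop)
    have hk' : Continuous (Function.uncurry fun x σ => kgOp (t - σ) (avgOp σ f₀) x) := by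
      refine continuous_kgOp (f := fun z : ℝ × ℝ => avgOp z.2 f₀) ?_ (by fun_prop) (by fun_prop)
      exact continuous_avgOp (f := fun _ => f₀) (by fun_prop) (by fun_prop) (by fun_prop)
    have hI : Continuous fun x => ∫ σ in (0 : ℝ)..t, kgOp (t - σ) (avgOp σ f₀) x :=
      continuous_intervalIntegral_of_continuous hk' continuous_const continuous_const
    have hav : ∀ σ, Continuous (avgOp σ f₀) := fun σ =>
      continuous_avgOp (f := fun _ => f₀) (by fun_prop) (by fun_prop) (by fun_prop)
    have hkb : ∀ σ ∈ uIcc 0 t, eLpNorm (fun x => kgOp (t - σ) (avgOp σ f₀) x) q volume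
        ≤ ENNReal.ofReal (T * R) * N₀ := by
      intro σ hσ
      rw [uIcc_of_le ht.1] at hσ
      exact (hkg (hav σ).measurable (t - σ)
        ⟨by linarith [hσ.2], by linarith [hσ.1, ht.2]⟩).trans
        (mul_le_mul_right (eLpNorm_avgOp_le hq h₀.1 σ) _)
    have hIb := eLpNorm_intervalIntegral_le hk.measurable hq hq' hkb
    have h2 : AEStronglyMeasurable
        ((1 / 4 : ℝ) • fun x => ∫ σ in (0 : ℝ)..t, kgOp (t - σ) (avgOp σ f₀) x) :=
      hI.aestronglyMeasurable.const_smul _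
    have h3 : AEStronglyMeasurable (avgOp t f₀) := (hav t).aestronglyMeasurable
    refine (eLpNorm_add_le (h3.add h2) (stronglyMeasurable_kgOp hf₁ t).aestronglyMeasurable
      hq).trans ?_
    gcongr
    · refine (eLpNorm_add_le h3 h2 hq).trans ?_
      gcongr
      · exact eLpNorm_avgOp_le hq h₀.1 t
      · rw [eLpNorm_const_smul]
        gcongr
        refine hIb.trans ?_
        gcongr
        rw [sub_zero, abs_of_nonneg ht.1]
        exact ht.2
    · exact hkg hf₁ t ht

end bounds

/-! ### Regularity in time of the solution -/

/-- The product rule for curves in `L^q`. -/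
theorem tendsto_slope_smul {q : ℝ≥0∞} (hq : 1 ≤ q) {a : ℝ → ℝ} {a' t : ℝ} {w : ℝ → ℝ → ℝ}
    {m : ℝ → ℝ} (ha : HasDerivAt a a' t) (hw : ∀ s, 0 ≤ s → MemLp (w s) q) (hm : MemLp m q)
    (ht : 0 ≤ t)
    (h : Tendsto (fun s => eLpNorm (fun x => (s - t)⁻¹ * (w s x - w t x) - m x) q volume)
      (𝓝[Ici 0 \ {t}] t) (𝓝 0)) :
    Tendsto (fun s => eLpNorm (fun x => (s - t)⁻¹ * (a s * w s x - a t * w t x)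
      - (a' * w t x + a t * m x)) q volume) (𝓝[Ici 0 \ {t}] t) (𝓝 0) := by
  have hac : Tendsto a (𝓝[Ici 0 \ {t}] t) (𝓝 (a t)) :=
    ha.continuousAt.tendsto.mono_left nhdsWithin_le_nhds
  have hsl : Tendsto (fun s => (s - t)⁻¹ * (a s - a t) - a') (𝓝[Ici 0 \ {t}] t) (𝓝 0) := by
    have h1 := (hasDerivAt_iff_tendsto_slope.1 ha).mono_left
      (nhdsWithin_mono t (fun s (hs : s ∈ Ici 0 \ {t}) => (hs.2 : s ∈ ({t} : Set ℝ)ᶜ)))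
    have h2 := h1.sub_const a'
    rw [sub_self] at h2
    refine h2.congr fun s => ?_
    rw [slope_def_field, div_eq_inv_mul]
  have e1 : Tendsto (fun s => ‖a s‖ₑ) (𝓝[Ici 0 \ {t}] t) (𝓝 ‖a t‖ₑ) :=
    (continuous_enorm.tendsto _).comp hac
  have e2 : Tendsto (fun s => ‖a s - a t‖ₑ) (𝓝[Ici 0 \ {t}] t) (𝓝 0) := by
    have h1 := hac.sub_const (a t)
    rw [sub_self] at h1
    simpa using h1.enorm
  have e3 : Tendsto (fun s => ‖(s - t)⁻¹ * (a s - a t) - a'‖ₑ) (𝓝[Ici 0 \ {t}] t) (𝓝 0) := by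
    simpa using hsl.enorm
  have h1 := ENNReal.Tendsto.mul e1 (Or.inr ENNReal.zero_ne_top) h (Or.inr enorm_ne_top)
  have h2 := ENNReal.Tendsto.mul_const (b := eLpNorm m q volume) e2 (Or.inr hm.2.ne)
  have h3 := ENNReal.Tendsto.mul_const (b := eLpNorm (w t) q volume) e3 (Or.inr (hw t ht).2.ne)
  have hsum := (h1.add h2).add h3
  simp only [mul_zero, zero_mul, add_zero] at hsum
  refine tendsto_of_tendsto_of_tendsto_of_le_of_le' tendsto_const_nhds hsum
    (Eventually.of_forall fun _ => zero_le) ?_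
  filter_upwards [self_mem_nhdsWithin] with s hs
  -- The error is `a(s)` times the slope error of `w`, plus `(a(s) - a(t)) m`, plus the slope error
  -- of `a` times `w t`.
  have m1 : MemLp (fun x => (s - t)⁻¹ * (w s x - w t x) - m x) q :=
    (((hw s hs.1).sub (hw t ht)).const_mul _).sub hm
  have m2 : AEStronglyMeasurable (a s • fun x => (s - t)⁻¹ * (w s x - w t x) - m x) :=
    m1.1.const_smul _
  have m3 : AEStronglyMeasurable ((a s - a t) • m) := hm.1.const_smul _
  have m4 : AEStronglyMeasurable (((s - t)⁻¹ * (a s - a t) - a') • w t) := (hw t ht).1.const_smul _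
  rw [← eLpNorm_const_smul, ← eLpNorm_const_smul, ← eLpNorm_const_smul]
  refine le_trans (le_of_eq ?_) ((eLpNorm_add_le (m2.add m3) m4 hq).trans
    (add_le_add_left (eLpNorm_add_le m2 m3 hq) _))
  congr 1
  ext x
  simp only [Pi.add_apply, Pi.smul_apply, smul_eq_mul]
  ring

/-- The regularity of solutions of the wave equation dominated by the Klein-Gordon evolution. -/
theorem continuousLq_of_dAlembert {q : ℝ≥0∞} (hq : 1 ≤ q) (hq' : q ≠ ⊤) {f₀ k f₁ : ℝ → ℝ}
    {w H : ℝ → ℝ → ℝ} (hf₀ : Continuous f₀) (hk : Measurable k) (hf₁ : Measurable f₁)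
    (hki : ∀ a b, IntervalIntegrable k volume a b) (hf₁i : ∀ a b, IntervalIntegrable f₁ volume a b)
    (hf₀k : ∀ a b, f₀ b - f₀ a = ∫ y in a..b, k y) (h₀ : MemLp f₀ q) (hkq : MemLp k q)
    (h₁ : MemLp f₁ q) (hw : Continuous (Function.uncurry w)) (hH : Continuous (Function.uncurry H))
    (hwz : ∀ t, 0 ≤ t → ∀ x, |w t x| ≤ kgAvgOp t f₀ x + kgOp t f₁ x)
    (hHw : ∀ t, 0 ≤ t → ∀ x, |H t x| ≤ |w t x|)
    (heq : ∀ t, 0 ≤ t → ∀ x, w t x = avgOp t f₀ x + waveOp t f₁ x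
      + ∫ τ in (0 : ℝ)..t, waveOp (t - τ) (H τ) x) :
    ContinuousLq q w ∧ (∀ ε, ContinuousLq q (charDeriv k f₁ H ε)) ∧
      ∀ t, 0 ≤ t → Tendsto (fun s => eLpNorm (fun x => (s - t)⁻¹ * (w s x - w t x)
        - (1 / 2 * charDeriv k f₁ H 1 t x + 1 / 2 * charDeriv k f₁ H (-1) t x)) q volume)
        (𝓝[Ici 0 \ {t}] t) (𝓝 0) := by
  -- Boundedness is bootstrapped to continuity: domination bounds `w`, hence `H`; then the
  -- characteristic derivatives are continuous, and `w` is recovered by integrating them in time.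
  have hwb : ∀ T, ∃ C : ℝ≥0∞, C ≠ ⊤ ∧ ∀ t ∈ Icc 0 T, eLpNorm (w t) q volume ≤ C := by
    intro T
    obtain ⟨C, hC, h⟩ := exists_bound_kgAvgOp_add_kgOp hq hq' hf₀ hf₁ h₀ h₁ T
    refine ⟨C, hC, fun t ht => le_trans (eLpNorm_mono fun x => ?_) (h t ht)⟩
    exact (hwz t ht.1 x).trans (le_abs_self _)
  have hHb : ∀ T, ∃ C : ℝ≥0∞, C ≠ ⊤ ∧ ∀ t ∈ Icc 0 T, eLpNorm (H t) q volume ≤ C := by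
    intro T
    obtain ⟨C, hC, h⟩ := hwb T
    exact ⟨C, hC, fun t ht => (eLpNorm_mono fun x => hHw t ht.1 x).trans (h t ht)⟩
  have hw0 : ∀ t, 0 ≤ t → MemLp (w t) q := by
    intro t ht
    obtain ⟨C, hC, h⟩ := hwb t
    have hc : Continuous (w t) := by fun_prop
    exact ⟨hc.aestronglyMeasurable, (h t ⟨ht, le_rfl⟩).trans_lt hC.lt_top⟩
  have hchar : ∀ ε, ContinuousLq q (charDeriv k f₁ H ε) := fun ε =>
    continuousLq_charDeriv hq hq' hkq h₁ hH hHb ε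
  set m : ℝ → ℝ → ℝ := fun t x =>
    1 / 2 * charDeriv k f₁ H 1 t x + 1 / 2 * charDeriv k f₁ H (-1) t x
  have hmc : ContinuousLq q m := ((hchar 1).const_mul hq _).add hq ((hchar (-1)).const_mul hq _)
  have hm : Measurable (Function.uncurry m) :=
    ((measurable_charDeriv hk hf₁ hH 1).const_mul _).add
      ((measurable_charDeriv hk hf₁ hH (-1)).const_mul _)
  have hmi : ∀ x a b, IntervalIntegrable (fun τ => m τ x) volume a b := fun x a b =>
    ((intervalIntegrable_charDeriv_time hki hf₁i hH (Or.inl rfl) x a b).const_mul _).add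
      ((intervalIntegrable_charDeriv_time hki hf₁i hH (Or.inr rfl) x a b).const_mul _)
  have hwm : ∀ t, 0 ≤ t → ∀ s, 0 ≤ s → ∀ x, w s x - w t x = ∫ τ in t..s, m τ x := by
    intro t ht s hs x
    rw [heq s hs, heq t ht, dAlembert_eq_add_integral hki hf₁i hH hf₀k ht,
      dAlembert_eq_add_integral hki hf₁i hH hf₀k hs, add_sub_add_left_eq_sub]
    exact intervalIntegral.integral_interval_sub_left (hmi x 0 s) (hmi x 0 t)
  refine ⟨continuousLq_of_integral hq hq' hm (fun T => hmc.exists_bound hq T) hw0 hwm, hchar,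
    fun t ht => ?_⟩
  exact tendsto_slope_of_integral hq hq' hm hmc hmi hwm ht

/-! ### The mild solution of the damped equation -/

/-- `S(t)` ignores null sets at every point `x`, so the data, and with them `∂_t S(t) u₀`, may be
computed from the continuous representative. -/
theorem S_congr_ae {f g : ℝ → ℝ} (h : f =ᵐ[volume] g) (t x : ℝ) : S t f x = S t g x := by
  have h' : ∀ᵐ y, f (x - y) = g (x - y) :=
    (Measure.measurePreserving_sub_left volume x).quasiMeasurePreserving.ae h
  unfold S
  congr 1
  refine intervalIntegral.integral_congr_ae ?_
  filter_upwards [h'] with y hy _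
  rw [hy]

theorem S_neg (f : ℝ → ℝ) (t x : ℝ) : S t (fun y => -f y) x = -S t f x := by
  simp only [S, mul_neg, intervalIntegral.integral_neg]

theorem kgOp_nonneg {f : ℝ → ℝ} {t : ℝ} (ht : 0 ≤ t) (hf : ∀ x, 0 ≤ f x) (x : ℝ) :
    0 ≤ kgOp t f x := by
  refine mul_nonneg (by norm_num) (intervalIntegral.integral_nonneg (by linarith) fun y hy => ?_)
  exact mul_nonneg (riemannFun_nonneg (by nlinarith [hy.1, hy.2])) (hf _)

/-- Existence of a nonnegative solution of the wave equation with absorption, together with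
Duhamel's formula for the propagator `S`. -/
theorem exists_nonneg_solution {p M : ℝ} (hp : 1 < p) (hM : 0 ≤ M) (hpM : p * M ^ (p - 1) ≤ 1 / 4)
    {f₀ f₁ : ℝ → ℝ} (hf₀ : Continuous f₀) (hf₁ : ∀ a b, IntervalIntegrable f₁ volume a b)
    (hb : ∀ t, 0 ≤ t → ∀ x, avgOp t f₀ x + waveOp t f₁ x ∈ Icc 0 M) :
    ∃ v : ℝ → ℝ → ℝ, Continuous (Function.uncurry v) ∧ (∀ t x, v t x ∈ Icc 0 M) ∧
      (∀ t, 0 ≤ t → ∀ x, Real.exp (t / 2) * v t x = avgOp t f₀ x + waveOp t f₁ x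
        + ∫ τ in (0 : ℝ)..t,
          waveOp (t - τ) (fun z => Real.exp (τ / 2) * (1 / 4 * v τ z - v τ z ^ p)) x) ∧
      (∀ t, 0 ≤ t → ∀ x,
        IntervalIntegrable (fun τ => S (t - τ) (fun y => v τ y ^ p) x) volume 0 t) ∧
      (∀ t, 0 ≤ t → ∀ x, v t x = Real.exp (-t / 2) * (kgAvgOp t f₀ x + kgOp t f₁ x)
        - ∫ τ in (0 : ℝ)..t, S (t - τ) (fun y => v τ y ^ p) x) ∧
      ∀ t, 0 ≤ t → ∀ x, Real.exp (t / 2) * v t x ≤ kgAvgOp t f₀ x + kgOp t f₁ x := by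
  have hbc : Continuous (Function.uncurry fun t x => avgOp t f₀ x + waveOp t f₁ x) := by
    have h1 : Continuous (Function.uncurry fun t x => avgOp t f₀ x) :=
      continuous_avgOp (f := fun _ => f₀) (by fun_prop) (by fun_prop) (by fun_prop)
    exact h1.add (continuous_waveOp_of_intervalIntegrable hf₁)
  obtain ⟨v, hvc, hv, heq⟩ := exists_wave_solution hp hM hpM hbc hb
  have hvp : Continuous (Function.uncurry fun τ z => v τ z ^ p) :=
    hvc.rpow_const fun _ => Or.inr (by linarith)
  have hF : Continuous (Function.uncurry fun τ z => Real.exp (τ / 2) * v τ z ^ p) :=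
    (by fun_prop : Continuous fun z : ℝ × ℝ => Real.exp (z.1 / 2)).mul hvp
  have hS : ∀ t, 0 ≤ t → ∀ x, ∀ τ ∈ uIcc 0 t, S (t - τ) (fun y => v τ y ^ p) x
      = Real.exp (-t / 2) * kgOp (t - τ) (fun z => Real.exp (τ / 2) * v τ z ^ p) x := by
    intro t ht x τ hτ
    rw [uIcc_of_le ht] at hτ
    rw [S_eq_exp_mul_kgOp (by linarith [hτ.2]), kgOp_const_mul, ← mul_assoc, ← Real.exp_add]
    congr 2
    ring
  have hcont : ∀ t x, Continuous fun τ =>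
      Real.exp (-t / 2) * kgOp (t - τ) (fun z => Real.exp (τ / 2) * v τ z ^ p) x := fun t x =>
    (continuous_kgOp (f := fun τ z => Real.exp (τ / 2) * v τ z ^ p) hF (by fun_prop)
      (by fun_prop)).const_mul _
  have hkg : ∀ t, 0 ≤ t → ∀ x, Real.exp (t / 2) * v t x = kgAvgOp t f₀ x + kgOp t f₁ x
      - ∫ τ in (0 : ℝ)..t, kgOp (t - τ) (fun z => Real.exp (τ / 2) * v τ z ^ p) x := by
    intro t ht x
    refine eq_duhamel_kgOp (w := fun t x => Real.exp (t / 2) * v t x)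
      (F := fun τ z => Real.exp (τ / 2) * v τ z ^ p) hf₀ hf₁ (by fun_prop) hF
      (fun t ht x => ?_) ht x
    rw [heq t ht]
    congr 1
    refine intervalIntegral.integral_congr fun τ _ => ?_
    congr 1
    ext z
    ring
  refine ⟨v, hvc, hv, heq, fun t ht x => ?_, fun t ht x => ?_, fun t ht x => ?_⟩
  · refine ((hcont t x).intervalIntegrable 0 t).congr fun τ hτ => ?_
    exact (hS t ht x τ (uIoc_subset_uIcc hτ)).symm
  · rw [intervalIntegral.integral_congr (hS t ht x), intervalIntegral.integral_const_mul, ← mul_sub,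
      ← hkg t ht x, ← mul_assoc, ← Real.exp_add]
    rw [show -t / 2 + t / 2 = 0 by ring, Real.exp_zero, one_mul]
  · rw [hkg t ht x]
    -- The absorption only lowers the solution: dropping it leaves the free evolution as an upper
    -- bound.
    have : 0 ≤ ∫ τ in (0 : ℝ)..t, kgOp (t - τ) (fun z => Real.exp (τ / 2) * v τ z ^ p) x := by
      refine intervalIntegral.integral_nonneg ht fun τ hτ => ?_
      exact kgOp_nonneg (by linarith [hτ.2]) (fun z =>
        mul_nonneg (Real.exp_pos _).le (Real.rpow_nonneg (hv τ z).1 p)) x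
    linarith

theorem ContinuousLq.continuousL1Lp {p : ℝ} {u : ℝ → ℝ → ℝ} (h1 : ContinuousLq 1 u)
    (hp : ContinuousLq (ENNReal.ofReal p) u) {I : Set ℝ} (hI : I ⊆ Ici 0) :
    ContinuousL1Lp p I u := fun t ht => by
  refine ⟨⟨(h1 t (hI ht)).1, (hp t (hI ht)).1⟩, ?_⟩
  have h := ((h1 t (hI ht)).2.add (hp t (hI ht)).2).mono_left (nhdsWithin_mono t hI)
  rwa [add_zero] at h

theorem _root_.MeasureTheory.MemLp.intervalIntegrable_one {f : ℝ → ℝ} (hf : MemLp f 1) (a b : ℝ) :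
    IntervalIntegrable f volume a b :=
  (memLp_one_iff_integrable.1 hf).intervalIntegrable

/-- A curve of primitives is continuous in `W^{1,1} ∩ W^{1,p}` if it is continuous in `L^1 ∩ L^p`
along with its space derivative. -/
theorem continuousW1Wp_of_primitive {p : ℝ} {u n : ℝ → ℝ → ℝ} (hu1 : ContinuousLq 1 u)
    (hup : ContinuousLq (ENNReal.ofReal p) u) (hn1 : ContinuousLq 1 n)
    (hnp : ContinuousLq (ENNReal.ofReal p) n) (huc : ∀ t, Continuous (u t))
    (hun : ∀ t, 0 ≤ t → ∀ a b, u t b - u t a = ∫ x in a..b, n t x) :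
    ContinuousW1Wp p (Ici 0) u := by
  have hw : ∀ t, 0 ≤ t → HasWeakDeriv (u t) (n t) := fun t ht =>
    hasWeakDeriv_of_primitive (huc t) ((hn1 t ht).1.locallyIntegrable le_rfl) (hun t ht)
  have hwd : ∀ s, 0 ≤ s → ∀ t, 0 ≤ t →
      HasWeakDeriv (fun x => u s x - u t x) (fun x => n s x - n t x) := by
    intro s hs t ht
    refine hasWeakDeriv_of_primitive ((huc s).sub (huc t))
      (((hn1 s hs).1.sub (hn1 t ht).1).locallyIntegrable le_rfl) fun a b => ?_
    rw [intervalIntegral.integral_sub ((hn1 s hs).1.intervalIntegrable_one a b)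
      ((hn1 t ht).1.intervalIntegrable_one a b), ← hun s hs, ← hun t ht]
    ring
  intro t ht
  refine ⟨⟨⟨(hu1 t ht).1, n t, hw t ht, (hn1 t ht).1⟩,
    ⟨(hup t ht).1, n t, hw t ht, (hnp t ht).1⟩⟩, ?_⟩
  have h := ((hu1 t ht).2.add (hn1 t ht).2).add ((hup t ht).2.add (hnp t ht).2)
  simp only [add_zero] at h
  refine tendsto_of_tendsto_of_tendsto_of_le_of_le' tendsto_const_nhds h
    (Eventually.of_forall fun _ => zero_le) ?_
  filter_upwards [self_mem_nhdsWithin] with s hs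
  exact add_le_add (iInf₂_le _ (hwd s hs t ht)) (iInf₂_le _ (hwd s hs t ht))

theorem nonneg_of_ae_nonneg {f : ℝ → ℝ} (hf : Continuous f) (h : ∀ᵐ x, 0 ≤ f x) (x : ℝ) :
    0 ≤ f x := by
  have h1 : (fun x => min (f x) 0) =ᵐ[volume] fun _ => 0 := by
    filter_upwards [h] with x hx using min_eq_right hx
  have h2 := Measure.eq_of_ae_eq h1 (by fun_prop) continuous_const
  exact min_eq_right_iff.1 (congrFun h2 x)

theorem waveOp_le_integral_abs {f : ℝ → ℝ} (hf : Integrable f) (t x : ℝ) :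
    waveOp t f x ≤ ∫ y, |f y| := by
  rw [waveOp, intervalIntegral.integral_comp_sub_left (fun z => f z)]
  have h1 : ∫ y in (x - t)..(x - -t), f y ≤ ∫ y, |f y| := by
    refine (le_abs_self _).trans
      ((intervalIntegral.norm_integral_le_integral_norm_uIoc (f := f)).trans ?_)
    exact setIntegral_le_integral hf.norm (Eventually.of_forall fun _ => norm_nonneg _)
  have h2 : 0 ≤ ∫ y, |f y| := integral_nonneg fun _ => abs_nonneg _
  linarith

theorem integral_abs_le_of_eLpNorm_le {f : ℝ → ℝ} (hf : MemLp f 1) {C : ℝ} (hC : 0 ≤ C)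
    (h : eLpNorm f 1 volume ≤ ENNReal.ofReal C) : ∫ y, |f y| ≤ C := by
  have h1 := ofReal_integral_norm_eq_lintegral_enorm (memLp_one_iff_integrable.1 hf)
  rw [eLpNorm_one_eq_lintegral_enorm, ← h1] at h
  exact (ENNReal.ofReal_le_ofReal_iff hC).1 h

/-- The solution of the Cauchy problem, for data given by a continuous nonnegative function with
integrable derivative and a nonnegative measurable function. -/
theorem exists_global_solution {p M : ℝ} (hp : 1 < p) (hM : 0 ≤ M)
    (hpM : p * M ^ (p - 1) ≤ 1 / 4) {u₀ u₁ f₀ k f₁ : ℝ → ℝ}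
    (hf₀ : Continuous f₀) (hk : Measurable k) (hf₁ : Measurable f₁)
    (hf₀k : ∀ a b, f₀ b - f₀ a = ∫ y in a..b, k y)
    (h₀ : MemL1Lp p f₀) (hkp : MemL1Lp p k) (h₁ : MemL1Lp p f₁)
    (hu₀ : u₀ =ᵐ[volume] fun x => -f₀ x)
    (hu₁ : (fun x => u₁ x + 1 / 2 * u₀ x) =ᵐ[volume] fun x => -f₁ x)
    (hb : ∀ t, 0 ≤ t → ∀ x, avgOp t f₀ x + waveOp t f₁ x ∈ Icc 0 M) :
    ∃ u : ℝ → ℝ → ℝ, IsGlobalMildSolution p u₀ u₁ u ∧ (∀ t, 0 ≤ t → ∀ x, u t x ≤ 0) ∧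
      ContinuousW1Wp p (Ici 0) u ∧ C1L1Lp p (Ioi 0) u := by
  have hki := hkp.1.intervalIntegrable_one
  have hf₁i := h₁.1.intervalIntegrable_one
  obtain ⟨v, hvc, hv, heq, hint, hduh, hle⟩ := exists_nonneg_solution hp hM hpM hf₀ hf₁i hb
  have hq : (1 : ℝ≥0∞) ≤ ENNReal.ofReal p := by
    rw [← ENNReal.ofReal_one]; exact ENNReal.ofReal_le_ofReal hp.le
  set w : ℝ → ℝ → ℝ := fun t x => Real.exp (t / 2) * v t x with hwdef
  set H : ℝ → ℝ → ℝ := fun τ z => Real.exp (τ / 2) * (1 / 4 * v τ z - v τ z ^ p) with hHdef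
  have hwc : Continuous (Function.uncurry w) := by fun_prop
  have hHc : Continuous (Function.uncurry H) := by
    have hvp : Continuous (Function.uncurry fun τ z => v τ z ^ p) :=
      hvc.rpow_const fun _ => Or.inr (by linarith)
    fun_prop
  have hw0 : ∀ t x, 0 ≤ w t x := fun t x => mul_nonneg (Real.exp_pos _).le (hv t x).1
  have hHw : ∀ t, 0 ≤ t → ∀ x, |H t x| ≤ |w t x| := by
    intro t _ x
    have h1 := rpow_sub_rpow_mem_Icc hp hpM le_rfl (hv t x).1 (hv t x).2
    rw [Real.zero_rpow (by linarith), sub_zero, sub_zero] at h1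
    simp only [hHdef, hwdef, abs_mul]
    refine mul_le_mul_of_nonneg_left ?_ (abs_nonneg _)
    rw [abs_le, abs_of_nonneg (hv t x).1]
    constructor <;> linarith [h1.1, h1.2, (hv t x).1]
  have hwz : ∀ t, 0 ≤ t → ∀ x, |w t x| ≤ kgAvgOp t f₀ x + kgOp t f₁ x := fun t ht x => by
    rw [abs_of_nonneg (hw0 t x)]
    exact hle t ht x
  have R1 := continuousLq_of_dAlembert le_rfl ENNReal.one_ne_top hf₀ hk hf₁ hki hf₁i hf₀k h₀.1
    hkp.1 h₁.1 hwc hHc hwz hHw heq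
  have Rp := continuousLq_of_dAlembert hq ENNReal.ofReal_ne_top hf₀ hk hf₁ hki hf₁i hf₀k h₀.2
    hkp.2 h₁.2 hwc hHc hwz hHw heq
  set a : ℝ → ℝ := fun t => -Real.exp (-t / 2) with hadef
  have hac : Continuous a := by fun_prop
  have ha : ∀ t, HasDerivAt a (1 / 2 * Real.exp (-t / 2)) t := fun t => by
    have h : HasDerivAt (fun s : ℝ => Real.exp (-s / 2)) (Real.exp (-t / 2) * (-1 / 2)) t :=
      (((hasDerivAt_id t).neg).div_const 2).exp
    exact h.neg.congr_deriv (by ring)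
  have haw : ∀ t x, a t * w t x = -v t x := fun t x => by
    simp only [hadef, hwdef]
    rw [neg_mul, ← mul_assoc, ← Real.exp_add, show -t / 2 + t / 2 = 0 by ring, Real.exp_zero,
      one_mul]
  set u : ℝ → ℝ → ℝ := fun t x => a t * w t x with hudef
  -- `charDeriv` with `ε = ±1` is `(∂_t ± ∂_x) w`, so `m` plays the role of `w_t` and `n` that of
  -- `w_x`.
  set m : ℝ → ℝ → ℝ := fun t x =>
    1 / 2 * charDeriv k f₁ H 1 t x + 1 / 2 * charDeriv k f₁ H (-1) t x with hmdef
  set n : ℝ → ℝ → ℝ := fun t x =>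
    1 / 2 * charDeriv k f₁ H 1 t x + -1 / 2 * charDeriv k f₁ H (-1) t x with hndef
  have hu1 : ContinuousLq 1 u := R1.1.smul le_rfl hac
  have hup : ContinuousLq (ENNReal.ofReal p) u := Rp.1.smul hq hac
  have hm1 : ContinuousLq 1 m :=
    ((R1.2.1 1).const_mul le_rfl _).add le_rfl ((R1.2.1 (-1)).const_mul le_rfl _)
  have hmp : ContinuousLq (ENNReal.ofReal p) m :=
    ((Rp.2.1 1).const_mul hq _).add hq ((Rp.2.1 (-1)).const_mul hq _)
  have hn1 : ContinuousLq 1 n :=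
    ((R1.2.1 1).const_mul le_rfl _).add le_rfl ((R1.2.1 (-1)).const_mul le_rfl _)
  have hnp : ContinuousLq (ENNReal.ofReal p) n :=
    ((Rp.2.1 1).const_mul hq _).add hq ((Rp.2.1 (-1)).const_mul hq _)
  have hSu₀ : ∀ s x, S s u₀ x = -S s f₀ x := fun s x => by rw [S_congr_ae hu₀, S_neg]
  have hdS : ∀ t, 0 ≤ t → ∀ x, HasDerivWithinAt (fun s => S s u₀ x)
      (-(Real.exp (-t / 2) * (kgAvgOp t f₀ x - 1 / 2 * kgOp t f₀ x))) (Ici 0) t := by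
    intro t ht x
    simp only [hSu₀]
    exact (hasDerivWithinAt_S hf₀ ht x).neg
  have habs : ∀ τ, (fun y => |u τ y| ^ p) = fun y => v τ y ^ p := fun τ => by
    ext y
    simp only [hudef]
    rw [haw, abs_neg, abs_of_nonneg (hv τ y).1]
  refine ⟨u, ⟨hu1.continuousL1Lp hup subset_rfl, fun t ht x => (hdS t ht x).differentiableWithinAt,
    fun t ht x => ?_, fun t ht x => ?_⟩, fun t ht x => ?_, ?_, ?_⟩
  · simp only [habs]
    exact hint t ht x
  · have hdt : dtS t u₀ x = -(Real.exp (-t / 2) * (kgAvgOp t f₀ x - 1 / 2 * kgOp t f₀ x)) :=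
      (hdS t ht x).derivWithin (uniqueDiffOn_Ici 0 t ht)
    -- The term `f₀/2` here cancels the `-1/2 kgOp` produced by differentiating `e^{-t/2}` in `∂_t
    -- S(t)`.
    have hsum : (fun y => u₀ y + u₁ y) =ᵐ[volume] fun y => -(1 / 2 * f₀ y + f₁ y) := by
      filter_upwards [hu₀, hu₁] with y h0 h1
      rw [h0] at h1 ⊢
      linarith
    have hS : S t (fun y => u₀ y + u₁ y) x
        = -(Real.exp (-t / 2) * (1 / 2 * kgOp t f₀ x + kgOp t f₁ x)) := by
      rw [S_congr_ae hsum, S_neg, S_eq_exp_mul_kgOp ht,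
        kgOp_add (fun a b => (hf₀.intervalIntegrable a b).const_mul _) hf₁i, kgOp_const_mul]
    simp only [habs]
    rw [hdt, hS]
    simp only [hudef]
    rw [haw, hduh t ht x]
    ring
  · simp only [hudef]
    rw [haw]
    linarith [(hv t x).1]
  · refine continuousW1Wp_of_primitive (n := fun t x => a t * n t x) hu1 hup
      (hn1.smul le_rfl hac) (hnp.smul hq hac) (fun _ => by fun_prop) fun t ht b c => ?_
    simp only [hudef]
    rw [intervalIntegral.integral_const_mul, ← mul_sub, show w t c = _ from heq t ht c,
      show w t b = _ from heq t ht b, dAlembert_sub_eq_integral hki hf₁i hHc hf₀k]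
  · refine ⟨hu1.continuousL1Lp hup Ioi_subset_Ici_self,
      fun t x => 1 / 2 * Real.exp (-t / 2) * w t x + a t * m t x, ?_, fun t ht => ?_⟩
    · have hec : Continuous fun t : ℝ => 1 / 2 * Real.exp (-t / 2) := by fun_prop
      exact ((R1.1.smul le_rfl hec).add le_rfl (hm1.smul le_rfl hac)).continuousL1Lp
        ((Rp.1.smul hq hec).add hq (hmp.smul hq hac)) Ioi_subset_Ici_self
    · have ht0 : (0 : ℝ) ≤ t := le_of_lt ht
      have h1 := tendsto_slope_smul le_rfl (ha t) (fun s hs => (R1.1 s hs).1) (hm1 t ht0).1 ht0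
        (R1.2.2 t ht0)
      have h2 := tendsto_slope_smul hq (ha t) (fun s hs => (Rp.1 s hs).1) (hmp t ht0).1 ht0
        (Rp.2.2 t ht0)
      have h := (h1.add h2).mono_left
        (nhdsWithin_mono t (sdiff_subset_sdiff_left (Ioi_subset_Ici_self (a := (0 : ℝ)))))
      rwa [add_zero] at h

end DampedWave

/-! ### Choice of the smallness constant -/

open DampedWave
theorem theorem2 (p : ℝ) (hp : 1 < p) :
    ∃ ε₁ : ℝ, 0 < ε₁ ∧
      ∀ u₀ u₁ : ℝ → ℝ, MemW1Wp p u₀ → MemL1Lp p u₁ →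
        normW1Wp p u₀ + normL1Lp p u₁ ≤ ENNReal.ofReal ε₁ →
        (∀ᵐ x, u₀ x ≤ 0) → (∀ᵐ x, u₁ x + (1 / 2) * u₀ x ≤ 0) →
        ∃ u : ℝ → ℝ → ℝ,
          IsGlobalMildSolution p u₀ u₁ u ∧
          (∀ t, 0 ≤ t → ∀ x, u t x ≤ 0) ∧
          ContinuousW1Wp p (Ici 0) u ∧
          C1L1Lp p (Ioi 0) u := by
  -- The solution of `p M^{p-1} = 1/4`.
  set M : ℝ := (1 / (4 * p)) ^ (1 / (p - 1)) with hMdef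
  have hp0 : 0 < p := by linarith
  have hM : 0 < M := Real.rpow_pos_of_pos (by positivity) _
  have hpM : p * M ^ (p - 1) ≤ 1 / 4 := by
    rw [hMdef, ← Real.rpow_mul (by positivity), one_div_mul_cancel (by linarith), Real.rpow_one]
    refine le_of_eq ?_
    field_simp
  -- Half of `M` is for `sup |u₀| ≤ ‖u₀'‖_{L^1}`, taken on the continuous representative, and half
  -- for the wave generated by `f₁`, at most `‖f₁‖_{L^1}`.
  refine ⟨M / 2, by positivity, fun u₀ u₁ h₀ h₁ hε hu₀ hu₁ => ?_⟩
  obtain ⟨F, k, hFc, hFu, hkm, hk1, hkp, hFk, hkn, hun⟩ := exists_continuous_rep h₀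
  have hg1 : MemLp (fun x => -(u₁ x + 1 / 2 * u₀ x)) 1 := (h₁.1.add (h₀.1.1.const_mul _)).neg
  have hgp : MemLp (fun x => -(u₁ x + 1 / 2 * u₀ x)) (ENNReal.ofReal p) :=
    (h₁.2.add (h₀.2.1.const_mul _)).neg
  set f₁ : ℝ → ℝ := hg1.1.mk _ with hf₁def
  have hf₁g : f₁ =ᵐ[volume] fun x => -(u₁ x + 1 / 2 * u₀ x) := hg1.1.ae_eq_mk.symm
  have hf₁m : Measurable f₁ := hg1.1.stronglyMeasurable_mk.measurable
  have hf₁1 : MemLp f₁ 1 := hg1.ae_eq hf₁g.symm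
  have hf₁i := memLp_one_iff_integrable.1 hf₁1
  have hF1 : MemLp F 1 := h₀.1.1.ae_eq hFu.symm
  have hFp : MemLp F (ENNReal.ofReal p) := h₀.2.1.ae_eq hFu.symm
  have hkb : ∫ y, |k y| ≤ M / 2 := integral_abs_le_of_eLpNorm_le hk1 (by positivity)
    (hkn.trans (le_self_add.trans hε))
  have hf₁b : ∫ y, |f₁ y| ≤ M / 2 := by
    refine integral_abs_le_of_eLpNorm_le hf₁1 (by positivity) (le_trans ?_ hε)
    rw [eLpNorm_congr_ae hf₁g]
    have e1 : (fun x => -(u₁ x + 1 / 2 * u₀ x)) = -(u₁ + (1 / 2 : ℝ) • u₀) := rfl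
    rw [e1, eLpNorm_neg, add_comm (normW1Wp p u₀)]
    refine (eLpNorm_add_le h₁.1.1 (h₀.1.1.1.const_smul _) le_rfl).trans ?_
    refine add_le_add le_self_add (le_trans ?_ hun)
    rw [eLpNorm_const_smul]
    -- The coefficient `1/2` in `f₁` is bounded by one, so `‖f₁‖_{L^1}` is controlled by the sum of
    -- the data norms.
    refine mul_le_of_le_one_left' ?_
    rw [Real.enorm_of_nonneg (by norm_num), ← ENNReal.ofReal_one]
    exact ENNReal.ofReal_le_ofReal (by norm_num)
  have hF0 : ∀ x, 0 ≤ -F x := nonneg_of_ae_nonneg hFc.neg (by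
    filter_upwards [hFu, hu₀] with x h1 h2
    rw [h1]; linarith)
  have hFb : ∀ x, -F x ≤ M / 2 := fun x =>
    ((neg_le_abs _).trans (abs_le_integral_abs_of_primitive (memLp_one_iff_integrable.1 hF1)
      (memLp_one_iff_integrable.1 hk1) hFk x)).trans hkb
  have hf₁0 : ∀ᵐ x, 0 ≤ f₁ x := by
    filter_upwards [hf₁g, hu₁] with x h1 h2
    rw [h1]; linarith
  refine exists_global_solution (f₀ := fun x => -F x) (k := fun x => -k x) hp hM.le hpM hFc.neg
    hkm.neg hf₁m (fun a b => ?_) ⟨hF1.neg, hFp.neg⟩ ⟨hk1.neg, hkp.neg⟩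
    ⟨hf₁1, hgp.ae_eq hf₁g.symm⟩ ?_ ?_ fun t ht x => ?_
  · rw [intervalIntegral.integral_neg, ← hFk]
    ring
  · filter_upwards [hFu] with x hx
    rw [hx, neg_neg]
  · filter_upwards [hf₁g] with x hx
    rw [hx, neg_neg]
  · have h1 := waveOp_nonneg ht hf₁0 x
    have h2 := (waveOp_le_integral_abs hf₁i t x).trans hf₁b
    have h3 : avgOp t (fun x => -F x) x = 1 / 2 * (-F (x + t) + -F (x - t)) := rfl
    rw [h3]
    constructor <;> linarith [hF0 (x + t), hF0 (x - t), hFb (x + t), hFb (x - t)]
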